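/- Let $\lambda>0$, $\Omega=(-\pi,\pi)\times(-1,1)$, and let $f:\mathbb R^2\to\mathbb R$ be continuous on the closed unit ball and compactly supported in the open unit ball (so $f=0$ outside it), with integrable Fourier transform on $\mathbb R^2$. Let $$\mathcal Rf(\vartheta,t)=\int_{\mathbb R} f(t\cos\vartheta-s\sin\vartheta,\;t\sin\vartheta+s\cos\vartheta)\,ds$$ be its Radon transform, assume $\mathcal Rf\in C^2(\overline\Omega)$, and let $\mathcal R^\lambda f=\mathcal M^\lambda(\mathcal Rf)$ with $\mathcal M^\lambda(t)=t-2\lambda\lfloor\frac{t+\lambda}{2\lambda}\rfloor$ be its modulo Radon transform. Function spaces. Let $C^\infty_{\rm per}$ be the smooth real functions of $(\vartheta,t)\in\mathbb R^2$ that are $2\pi$-periodic in $\vartheta$ and $2$-periodic in $t$, and $C^\infty_{{\rm per},D}$ those $\varphi\in C^\infty_{\rm per}$ for which some $r\in(0,1)$ satisfies $\varphi(\vartheta,t)=0$ whenever $\vartheta\in(-\pi,\pi)$ and $r\le|t|\le1$. Let $L^2_{\rm per}=L^2(\Omega)$, functions on $\Omega$ being identified with functions on the torus $[-\pi,\pi]\times[-1,1]$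 with opposite boundary points identified. Let $H^1_{\rm per}$ be the space of $u\in L^2_{\rm per}$ with weak partial derivatives $\partial_\vartheta u,\partial_t u\in L^2_{\rm per}$ (tested against $C^\infty_{\rm per}$), with norm $(\|u\|^2+\|\partial_\vartheta u\|^2+\|\partial_t u\|^2)^{1/2}$, and let $H^1_{{\rm per},D}$ be the closure of $C^\infty_{{\rm per},D}$ in $H^1_{\rm per}$. Then the following hold. 1. The functions $\sin(\frac\pi\lambda\mathcal R^\lambda f)$ and $\cos(\frac\pi\lambda\mathcal R^\lambda f)$ belong to $C^2(\overline\Omega)$, and $$\mathcal R^\lambda_\Delta(f)=\tfrac\lambda\pi\Big[\cos(\tfrac\pi\lambda\mathcal R^\lambda f)\,\Delta\sin(\tfrac\pi\lambda\mathcal R^\lambda f)-\sin(\tfrac\pi\lambda\mathcal R^\lambda f)\,\Delta\cos(\tfrac\pi\lambda\mathcal R^\lambda f)\Big]$$ belongs to $L^2_{\rm per}$. 2. The Poisson problem $\Delta u=\mathcal R^\lambda_\Delta(f)$ on $\Omega$, with $u=0$ at $t=\pm1$ and $u,\partial_\vartheta u$ $2\pi$-periodic in $\vartheta$, has exactly one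 weak solution up to equality almost everywhere on $\Omega$, i.e. exactly one $u\in H^1_{{\rm per},D}$ with $$\int_\Omega\nabla u\cdot\nabla v\,d(\vartheta,t)=-\int_\Omega v\,\mathcal R^\lambda_\Delta(f)\,d(\vartheta,t)\qquad\text{for all }v\in H^1_{{\rm per},D}.$$ Denote it by $\Delta^{-1}\mathcal R^\lambda_\Delta(f)$, and extend it by zero to $(-\pi,\pi)\times\mathbb R$. 3. For every $x\in\mathbb R^2$, $$f(x)=\frac1{4\pi}\,\mathcal B\Big(\mathcal F_1^{-1}\big[|S|\,\mathcal F_1(\Delta^{-1}\mathcal R^\lambda_\Delta(f))(\vartheta,S)\big]\Big)(x),$$ where $\mathcal F_1g(\vartheta,S)=\int_{\mathbb R}g(\vartheta,t)e^{-iSt}\,dt$, $\mathcal F_1^{-1}G(\vartheta,t)=\frac1{2\pi}\int_{\mathbb R}G(\vartheta,S)e^{iSt}\,dS$ and $\mathcal Bg(x)=\int_{-\pi}^{\pi}g(\vartheta,x_1\cos\vartheta+x_2\sin\vartheta)\,d\vartheta$. Here the integrals defining $\mathcal F_1$ and $\mathcal F_1^{-1}$ converge absolutely for almost every $\vartheta\in(-\pi,\pi)$,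 and the integral defining $\mathcal B$ converges absolutely for every $x$. -/

import Mathlib

open MeasureTheory Set Filter Topology
open scoped FourierTransform ContDiff

noncomputable section

namespace ModuloRadon

/-- The Euclidean plane. -/
abbrev Plane : Type := EuclideanSpace ℝ (Fin 2)

/-! ### Radon transform, modulo Radon transform -/

/-- The Radon transform, as a function of `(ϑ, t)`. -/
def radon (f : Plane → ℝ) : ℝ × ℝ → ℝ := fun z =>
  ∫ s : ℝ, f !₂[z.2 * Real.cos z.1 - s * Real.sin z.1, z.2 * Real.sin z.1 + s * Real.cos z.1]

/-- The `2λ`-modulo operator. -/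
def modulo (lam : ℝ) (t : ℝ) : ℝ := t - 2 * lam * (⌊(t + lam) / (2 * lam)⌋ : ℝ)

/-- The modulo Radon transform `R^λ f`. -/
def moduloRadon (lam : ℝ) (f : Plane → ℝ) : ℝ × ℝ → ℝ := fun z => modulo lam (radon f z)

/-! ### Partial derivatives and the right-hand side of the Poisson problem -/

/-- The open rectangle `Ω = (-π, π) × (-1, 1)`. -/
def Omega : Set (ℝ × ℝ) := Ioo (-Real.pi) Real.pi ×ˢ Ioo (-1) 1

/-- The classical partial derivative with respect to `ϑ`. -/
def dTheta (g : ℝ × ℝ → ℝ) : ℝ × ℝ → ℝ := fun z => deriv (fun s => g (s, z.2)) z.1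

/-- The classical partial derivative with respect to `t`. -/
def dT (g : ℝ × ℝ → ℝ) : ℝ × ℝ → ℝ := fun z => deriv (fun s => g (z.1, s)) z.2

/-- The classical Laplacian in the variables `(ϑ, t)`. -/
def laplace (g : ℝ × ℝ → ℝ) : ℝ × ℝ → ℝ := fun z => dTheta (dTheta g) z + dT (dT g) z

/-- `sin (π / λ · p)` for sinogram data `p`. -/
def sinPhase (lam : ℝ) (p : ℝ × ℝ → ℝ) : ℝ × ℝ → ℝ := fun z => Real.sin (Real.pi / lam * p z)

/-- `cos (π / λ · p)` for sinogram data `p`. -/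
def cosPhase (lam : ℝ) (p : ℝ × ℝ → ℝ) : ℝ × ℝ → ℝ := fun z => Real.cos (Real.pi / lam * p z)

/-- `λ / π · [cos (π/λ p) Δ sin (π/λ p) - sin (π/λ p) Δ cos (π/λ p)]`; for `p = R^λ f` this is
the right-hand side `R^λ_Δ (f)` of the Poisson problem. -/
def poissonRhs (lam : ℝ) (p : ℝ × ℝ → ℝ) : ℝ × ℝ → ℝ := fun z =>
  lam / Real.pi * (cosPhase lam p z * laplace (sinPhase lam p) z
    - sinPhase lam p z * laplace (cosPhase lam p) z)

/-! ### Periodic function spaces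

The torus is `[-π, π] × [-1, 1]` with opposite boundary points identified. The boundary is a null
set, so an element of `L²` of the torus is represented by a function whose values matter only
almost everywhere on `Omega`. Periodicity enters through the test functions. -/

/-- `u ∈ L²_per`. -/
def MemL2per (u : ℝ × ℝ → ℝ) : Prop := MemLp u 2 (volume.restrict Omega)

/-- `φ ∈ C^∞_per`: smooth functions on the torus, as periodic functions on the plane. -/
structure IsSmoothPer (φ : ℝ × ℝ → ℝ) : Prop where
  smooth : ContDiff ℝ ∞ φ
  periodic_theta : ∀ ϑ t : ℝ, φ (ϑ + 2 * Real.pi, t) = φ (ϑ, t)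
  periodic_t : ∀ ϑ t : ℝ, φ (ϑ, t + 2) = φ (ϑ, t)

/-- `φ ∈ C^∞_{per,D}`: smooth periodic functions that vanish near `t = ± 1`. -/
def IsSmoothPerD (φ : ℝ × ℝ → ℝ) : Prop :=
  IsSmoothPer φ ∧ ∃ r : ℝ, 0 < r ∧ r < 1 ∧
    ∀ ϑ ∈ Ioo (-Real.pi) Real.pi, ∀ t ∈ Icc (-1 : ℝ) 1, t ∉ Ioo (-r) r → φ (ϑ, t) = 0

/-- `u ∈ H¹_per`, and `(p, q)` is its weak gradient on the torus: `p = ∂_ϑ u`, `q = ∂_t u`. -/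
structure IsH1per (u p q : ℝ × ℝ → ℝ) : Prop where
  memL2 : MemL2per u
  memL2_theta : MemL2per p
  memL2_t : MemL2per q
  weak_theta : ∀ φ, IsSmoothPer φ →
    ∫ z in Omega, u z * dTheta φ z = - ∫ z in Omega, p z * φ z
  weak_t : ∀ φ, IsSmoothPer φ →
    ∫ z in Omega, u z * dT φ z = - ∫ z in Omega, q z * φ z

/-- The `H¹_per` norm of a function `u` with weak gradient `(p, q)`. -/
def h1perNorm (u p q : ℝ × ℝ → ℝ) : ℝ :=
  Real.sqrt ((∫ z in Omega, u z ^ 2) + (∫ z in Omega, p z ^ 2) + ∫ z in Omega, q z ^ 2)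

/-- `u ∈ H¹_{per,D}`, the closure of `C^∞_{per,D}` in `H¹_per`, and `(p, q)` is the weak gradient
of `u`. -/
def IsH1perD (u p q : ℝ × ℝ → ℝ) : Prop :=
  IsH1per u p q ∧ ∀ ε : ℝ, 0 < ε → ∃ φ, IsSmoothPerD φ ∧
    h1perNorm (fun z => u z - φ z) (fun z => p z - dTheta φ z) (fun z => q z - dT φ z) < ε

/-- `u ∈ H¹_{per,D}` is a weak solution of `Δ u = g` on `Ω` with homogeneous Dirichlet conditions
at `t = ± 1` and periodic conditions in `ϑ`. -/
def IsWeakSolution (g u : ℝ × ℝ → ℝ) : Prop :=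
  ∃ p q, IsH1perD u p q ∧ ∀ v r s, IsH1perD v r s →
    ∫ z in Omega, (p z * r z + q z * s z) = - ∫ z in Omega, v z * g z

/-! ### Filtered back projection -/

/-- Extension by zero from `Omega` to the strip (and to the plane). -/
def zeroExt (u : ℝ × ℝ → ℝ) : ℝ × ℝ → ℂ := fun z => ((Omega.indicator u z : ℝ) : ℂ)

/-- The Fourier transform in the second variable, `∫ g(ϑ, t) e^{-i S t} dt`. -/
def fourier1 (g : ℝ × ℝ → ℂ) : ℝ × ℝ → ℂ := fun z =>
  ∫ t : ℝ, g (z.1, t) * Complex.exp (-(Complex.I * (z.2 : ℂ) * (t : ℂ)))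

/-- The inverse Fourier transform in the second variable, `(2π)⁻¹ ∫ G(ϑ, S) e^{i S t} dS`. -/
def invFourier1 (G : ℝ × ℝ → ℂ) : ℝ × ℝ → ℂ := fun z =>
  1 / (2 * (Real.pi : ℂ)) * ∫ S : ℝ, G (z.1, S) * Complex.exp (Complex.I * (S : ℂ) * (z.2 : ℂ))

/-- Multiplication by `|S|`. -/
def ramp (G : ℝ × ℝ → ℂ) : ℝ × ℝ → ℂ := fun z => ((|z.2| : ℝ) : ℂ) * G z

/-- The integrand of the back projection at the point `x`. -/
def backProjectionIntegrand (g : ℝ × ℝ → ℂ) (x : Plane) : ℝ → ℂ := fun ϑ =>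
  g (ϑ, x 0 * Real.cos ϑ + x 1 * Real.sin ϑ)

/-- The back projection. -/
def backProjection (g : ℝ × ℝ → ℂ) (x : Plane) : ℂ :=
  ∫ ϑ in Ioo (-Real.pi) Real.pi, backProjectionIntegrand g x ϑ

end ModuloRadon

end

open ModuloRadon

namespace ModuloRadon

/-! ### Calculus on the rectangle -/

/-! The modulo operator changes `radon f` by integer multiples of `2λ`, which sine and cosine of
`π/λ` times the data do not see. For a `C²` phase the chain rule makes the squared-gradient terms
cancel in `cos Δ sin - sin Δ cos`, so the right-hand side is the Laplacian of the true sinogram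
(`poissonRhs_eq_laplace`).

Hence no abstract existence theorem is needed: `radon f` is itself a weak solution. It is globally
`C²` (`contDiff_radon`), periodic in `ϑ`, and zero near `t = ± 1`. Mollification followed by
periodization in `t` places it in `H¹_{per,D}`, and Green's identity, extended from smooth test
functions to their closure, gives the weak equation (`integral_grad_mul`). Uniqueness comes from
testing the difference of two solutions with itself and applying the Poincaré inequality in `t`.

Every weak solution therefore agrees with `radon f` almost everywhere on the rectangle, and what
remains is classical filtered back projection: the Fourier slice theorem, polar coordinates with
signed radius (`polar_signed`) and Fourier inversion on the plane. -/

theorem hasDerivAt_fst {F : ℝ × ℝ → ℝ} (hF : ContDiff ℝ 1 F) (z : ℝ × ℝ) :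
    HasDerivAt (fun s => F (s, z.2)) (fderiv ℝ F z (1, 0)) z.1 := by
  have h1 : HasFDerivAt F (fderiv ℝ F z) (z.1, z.2) :=
    (hF.differentiable one_ne_zero z).hasFDerivAt
  exact h1.comp_hasDerivAt z.1 ((hasDerivAt_id z.1).prodMk (hasDerivAt_const z.1 z.2))

theorem hasDerivAt_snd {F : ℝ × ℝ → ℝ} (hF : ContDiff ℝ 1 F) (z : ℝ × ℝ) :
    HasDerivAt (fun s => F (z.1, s)) (fderiv ℝ F z (0, 1)) z.2 := by
  have h1 : HasFDerivAt F (fderiv ℝ F z) (z.1, z.2) :=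
    (hF.differentiable one_ne_zero z).hasFDerivAt
  exact h1.comp_hasDerivAt z.2 ((hasDerivAt_const z.2 z.1).prodMk (hasDerivAt_id z.2))

theorem dTheta_eq_fderiv {F : ℝ × ℝ → ℝ} (hF : ContDiff ℝ 1 F) :
    dTheta F = fun z => fderiv ℝ F z (1, 0) :=
  funext fun z => (hasDerivAt_fst hF z).deriv

theorem dT_eq_fderiv {F : ℝ × ℝ → ℝ} (hF : ContDiff ℝ 1 F) :
    dT F = fun z => fderiv ℝ F z (0, 1) :=
  funext fun z => (hasDerivAt_snd hF z).deriv

theorem hasDerivAt_dTheta {F : ℝ × ℝ → ℝ} (hF : ContDiff ℝ 1 F) (z : ℝ × ℝ) :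
    HasDerivAt (fun s => F (s, z.2)) (dTheta F z) z.1 := by
  rw [dTheta_eq_fderiv hF]; exact hasDerivAt_fst hF z

theorem hasDerivAt_dT {F : ℝ × ℝ → ℝ} (hF : ContDiff ℝ 1 F) (z : ℝ × ℝ) :
    HasDerivAt (fun s => F (z.1, s)) (dT F z) z.2 := by
  rw [dT_eq_fderiv hF]; exact hasDerivAt_snd hF z

theorem contDiff_dTheta {F : ℝ × ℝ → ℝ} (hF : ContDiff ℝ 2 F) : ContDiff ℝ 1 (dTheta F) := by
  rw [dTheta_eq_fderiv (hF.of_le (by norm_num))]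
  exact (hF.fderiv_right (m := 1) (by norm_num)).clm_apply contDiff_const

theorem contDiff_dT {F : ℝ × ℝ → ℝ} (hF : ContDiff ℝ 2 F) : ContDiff ℝ 1 (dT F) := by
  rw [dT_eq_fderiv (hF.of_le (by norm_num))]
  exact (hF.fderiv_right (m := 1) (by norm_num)).clm_apply contDiff_const

theorem continuous_dTheta {F : ℝ × ℝ → ℝ} (hF : ContDiff ℝ 1 F) : Continuous (dTheta F) := by
  rw [dTheta_eq_fderiv hF]
  exact (hF.continuous_fderiv one_ne_zero).clm_apply continuous_const

theorem continuous_dT {F : ℝ × ℝ → ℝ} (hF : ContDiff ℝ 1 F) : Continuous (dT F) := by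
  rw [dT_eq_fderiv hF]
  exact (hF.continuous_fderiv one_ne_zero).clm_apply continuous_const

theorem continuous_laplace {F : ℝ × ℝ → ℝ} (hF : ContDiff ℝ 2 F) : Continuous (laplace F) :=
  (continuous_dTheta (contDiff_dTheta hF)).add (continuous_dT (contDiff_dT hF))

theorem dTheta_mul {F G : ℝ × ℝ → ℝ} (hF : ContDiff ℝ 1 F) (hG : ContDiff ℝ 1 G) (z : ℝ × ℝ) :
    dTheta (fun z => F z * G z) z = dTheta F z * G z + F z * dTheta G z :=
  ((hasDerivAt_dTheta hF z).mul (hasDerivAt_dTheta hG z)).deriv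

theorem dT_mul {F G : ℝ × ℝ → ℝ} (hF : ContDiff ℝ 1 F) (hG : ContDiff ℝ 1 G) (z : ℝ × ℝ) :
    dT (fun z => F z * G z) z = dT F z * G z + F z * dT G z :=
  ((hasDerivAt_dT hF z).mul (hasDerivAt_dT hG z)).deriv

theorem measurableSet_Omega : MeasurableSet Omega := measurableSet_Ioo.prod measurableSet_Ioo

theorem isOpen_Omega : IsOpen Omega := isOpen_Ioo.prod isOpen_Ioo

theorem closure_Omega : closure Omega = Icc (-Real.pi) Real.pi ×ˢ Icc (-1) 1 := by
  have := Real.pi_pos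
  rw [Omega, closure_prod_eq, closure_Ioo (by linarith), closure_Ioo (by norm_num)]

theorem isCompact_closure_Omega : IsCompact (closure Omega) := by
  rw [closure_Omega]; exact isCompact_Icc.prod isCompact_Icc

instance isFiniteMeasure_restrict_Omega : IsFiniteMeasure (volume.restrict Omega) :=
  ⟨by
    rw [Measure.restrict_apply_univ]
    exact (measure_mono subset_closure).trans_lt isCompact_closure_Omega.measure_lt_top⟩

theorem integrableOn_Omega {F : ℝ × ℝ → ℝ} (hF : Continuous F) : IntegrableOn F Omega :=
  (hF.continuousOn.integrableOn_compact isCompact_closure_Omega).mono_set subset_closure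

theorem memL2per_of_continuous {F : ℝ × ℝ → ℝ} (hF : Continuous F) : MemL2per F := by
  obtain ⟨C, hC⟩ := isCompact_closure_Omega.exists_bound_of_continuousOn hF.continuousOn
  refine MemLp.of_bound hF.aestronglyMeasurable C ?_
  filter_upwards [ae_restrict_mem measurableSet_Omega] with z hz using hC z (subset_closure hz)

theorem integral_dTheta_eq_zero {F : ℝ × ℝ → ℝ} (hF : ContDiff ℝ 1 F)
    (h : ∀ t ∈ Ioo (-1 : ℝ) 1, F (Real.pi, t) = F (-Real.pi, t)) :
    ∫ z in Omega, dTheta F z = 0 := by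
  have hpi := Real.pi_pos
  have hc := continuous_dTheta hF
  have hint : Integrable (dTheta F) ((volume.restrict (Ioo (-Real.pi) Real.pi)).prod
      (volume.restrict (Ioo (-1 : ℝ) 1))) := by
    rw [Measure.prod_restrict]; exact integrableOn_Omega hc
  rw [Omega, Measure.volume_eq_prod, ← Measure.prod_restrict, integral_prod_symm _ hint]
  rw [← integral_zero ℝ ℝ (μ := volume.restrict (Ioo (-1 : ℝ) 1))]
  refine setIntegral_congr_fun measurableSet_Ioo fun t ht => ?_
  have := intervalIntegral.integral_eq_sub_of_hasDerivAt (a := -Real.pi) (b := Real.pi)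
    (f := fun x => F (x, t)) (f' := fun x => dTheta F (x, t))
    (fun x _ => hasDerivAt_dTheta hF (x, t))
    ((hc.comp (by fun_prop : Continuous fun x : ℝ => (x, t))).intervalIntegrable _ _)
  rw [intervalIntegral.integral_of_le (by linarith), integral_Ioc_eq_integral_Ioo] at this
  simpa [h t ht] using this

theorem integral_dT_eq_zero {F : ℝ × ℝ → ℝ} (hF : ContDiff ℝ 1 F)
    (h : ∀ ϑ ∈ Ioo (-Real.pi) Real.pi, F (ϑ, 1) = F (ϑ, -1)) :
    ∫ z in Omega, dT F z = 0 := by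
  have hc := continuous_dT hF
  have hint : Integrable (dT F) ((volume.restrict (Ioo (-Real.pi) Real.pi)).prod
      (volume.restrict (Ioo (-1 : ℝ) 1))) := by
    rw [Measure.prod_restrict]; exact integrableOn_Omega hc
  rw [Omega, Measure.volume_eq_prod, ← Measure.prod_restrict, integral_prod _ hint]
  rw [← integral_zero ℝ ℝ (μ := volume.restrict (Ioo (-Real.pi) Real.pi))]
  refine setIntegral_congr_fun measurableSet_Ioo fun x hx => ?_
  have := intervalIntegral.integral_eq_sub_of_hasDerivAt (a := (-1 : ℝ)) (b := 1)
    (f := fun t => F (x, t)) (f' := fun t => dT F (x, t))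
    (fun t _ => hasDerivAt_dT hF (x, t))
    ((hc.comp (by fun_prop : Continuous fun t : ℝ => (x, t))).intervalIntegrable _ _)
  rw [intervalIntegral.integral_of_le (by norm_num), integral_Ioc_eq_integral_Ioo] at this
  simpa [h x hx] using this

theorem integral_mul_dTheta {F G : ℝ × ℝ → ℝ} (hF : ContDiff ℝ 1 F) (hG : ContDiff ℝ 1 G)
    (h : ∀ t ∈ Ioo (-1 : ℝ) 1, F (Real.pi, t) * G (Real.pi, t) = F (-Real.pi, t) * G (-Real.pi, t)) :
    ∫ z in Omega, F z * dTheta G z = - ∫ z in Omega, dTheta F z * G z := by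
  have h0 := integral_dTheta_eq_zero (hF.mul hG) h
  simp_rw [dTheta_mul hF hG] at h0
  have h1 : IntegrableOn (fun z => dTheta F z * G z) Omega :=
    integrableOn_Omega ((continuous_dTheta hF).mul hG.continuous)
  have h2 : IntegrableOn (fun z => F z * dTheta G z) Omega :=
    integrableOn_Omega (hF.continuous.mul (continuous_dTheta hG))
  rw [integral_add h1 h2] at h0
  linarith

theorem integral_mul_dT {F G : ℝ × ℝ → ℝ} (hF : ContDiff ℝ 1 F) (hG : ContDiff ℝ 1 G)
    (h : ∀ ϑ ∈ Ioo (-Real.pi) Real.pi, F (ϑ, 1) * G (ϑ, 1) = F (ϑ, -1) * G (ϑ, -1)) :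
    ∫ z in Omega, F z * dT G z = - ∫ z in Omega, dT F z * G z := by
  have h0 := integral_dT_eq_zero (hF.mul hG) h
  simp_rw [dT_mul hF hG] at h0
  have h1 : IntegrableOn (fun z => dT F z * G z) Omega :=
    integrableOn_Omega ((continuous_dT hF).mul hG.continuous)
  have h2 : IntegrableOn (fun z => F z * dT G z) Omega :=
    integrableOn_Omega (hF.continuous.mul (continuous_dT hG))
  rw [integral_add h1 h2] at h0
  linarith

/-! ### Mollification -/

/-- Convolution with a kernel `ψ`. -/
noncomputable def mollify (ψ p : ℝ × ℝ → ℝ) : ℝ × ℝ → ℝ :=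
  convolution ψ p (ContinuousLinearMap.lsmul ℝ ℝ) volume

theorem mollify_apply (ψ p : ℝ × ℝ → ℝ) (z : ℝ × ℝ) : mollify ψ p z = ∫ y, ψ y * p (z - y) := rfl

/-- The derivative is put on `p`, not on the kernel, so that first derivatives of a mollification
are mollifications of continuous functions and converge uniformly on the rectangle. -/
theorem hasDerivAt_mollify_line {ψ p : ℝ × ℝ → ℝ} (hψ : Continuous ψ) (hs : HasCompactSupport ψ)
    (hp : ContDiff ℝ 1 p) (w e : ℝ × ℝ) (s₀ : ℝ) :
    HasDerivAt (fun s : ℝ => mollify ψ p (w + s • e))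
      (mollify ψ (fun z => fderiv ℝ p z e) (w + s₀ • e)) s₀ := by
  have hd : Continuous fun z => fderiv ℝ p z e :=
    (hp.continuous_fderiv one_ne_zero).clm_apply continuous_const
  have hpc := hp.continuous
  obtain ⟨M, hM⟩ := (isCompact_Icc.prod hs : IsCompact (Icc (s₀ - 1) (s₀ + 1) ×ˢ tsupport ψ))
    |>.exists_bound_of_continuousOn (f := fun q : ℝ × (ℝ × ℝ) => fderiv ℝ p (w + q.1 • e - q.2) e)
      (by fun_prop)
  refine (hasDerivAt_integral_of_dominated_loc_of_deriv_le (μ := volume)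
    (F := fun s y => ψ y * p (w + s • e - y))
    (F' := fun s y => ψ y * fderiv ℝ p (w + s • e - y) e) (bound := fun y => |ψ y| * M)
    (Icc_mem_nhds (by linarith : s₀ - 1 < s₀) (by linarith : s₀ < s₀ + 1)) ?_ ?_ ?_ ?_ ?_ ?_).2
  · exact Eventually.of_forall fun s =>
      (by fun_prop : Continuous fun y => ψ y * p (w + s • e - y)).aestronglyMeasurable
  · exact (by fun_prop : Continuous fun y => ψ y * p (w + s₀ • e - y)).integrable_of_hasCompactSupport
      hs.mul_right
  · exact (by fun_prop : Continuous fun y => ψ y * fderiv ℝ p (w + s₀ • e - y) e).aestronglyMeasurable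
  · refine Eventually.of_forall fun y s hsm => ?_
    rw [norm_mul, Real.norm_eq_abs (ψ y)]
    by_cases hy : y ∈ tsupport ψ
    · exact mul_le_mul_of_nonneg_left (hM (s, y) ⟨hsm, hy⟩) (abs_nonneg _)
    · simp [image_eq_zero_of_notMem_tsupport hy]
  · exact (hψ.abs.integrable_of_hasCompactSupport hs.norm).mul_const M
  · refine Eventually.of_forall fun y s _ => ?_
    have h1 : HasDerivAt (fun s : ℝ => w + s • e - y) e s := by
      simpa using (((hasDerivAt_id s).smul_const e).const_add w).sub_const y
    exact (((hp.differentiable one_ne_zero _).hasFDerivAt).comp_hasDerivAt s h1).const_mul (ψ y)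

theorem dTheta_mollify {ψ p : ℝ × ℝ → ℝ} (hψ : Continuous ψ) (hs : HasCompactSupport ψ)
    (hp : ContDiff ℝ 1 p) : dTheta (mollify ψ p) = mollify ψ (dTheta p) := by
  funext z
  have := (hasDerivAt_mollify_line hψ hs hp (0, z.2) (1, 0) z.1).deriv
  rw [← dTheta_eq_fderiv hp] at this
  simpa [dTheta] using this

theorem dT_mollify {ψ p : ℝ × ℝ → ℝ} (hψ : Continuous ψ) (hs : HasCompactSupport ψ)
    (hp : ContDiff ℝ 1 p) : dT (mollify ψ p) = mollify ψ (dT p) := by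
  funext z
  have := (hasDerivAt_mollify_line hψ hs hp (z.1, 0) (0, 1) z.2).deriv
  rw [← dT_eq_fderiv hp] at this
  simpa [dT] using this

theorem exists_mollify_close {p : ℝ × ℝ → ℝ} (hp : Continuous p) {ε : ℝ} (hε : 0 < ε) :
    ∃ δ > 0, ∀ φ : ContDiffBump (0 : ℝ × ℝ), φ.rOut ≤ δ → ∀ z ∈ closure Omega,
      |p z - mollify (φ.normed volume) p z| ≤ ε := by
  have h := isCompact_closure_Omega.uniformContinuousAt_of_continuousAt p
    (fun a _ => hp.continuousAt) (Metric.dist_mem_uniformity hε)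
  obtain ⟨δ, hδ, hδ'⟩ := Metric.mem_uniformity_dist.1 h
  refine ⟨δ, hδ, fun φ hφ z hz => ?_⟩
  rw [abs_sub_comm, ← Real.dist_eq]
  refine φ.dist_normed_convolution_le hp.aestronglyMeasurable fun x hx => ?_
  have hzx : dist z x < δ := by rw [dist_comm]; exact (Metric.mem_ball.1 hx).trans_le hφ
  have h2 : dist (p z) (p x) < ε := hδ' hzx hz
  rw [dist_comm]; exact h2.le

/-! ### Periodization -/

/-- The representative of `t` modulo `2` closest to zero. -/
noncomputable def wrap (t : ℝ) : ℝ := t - 2 * round (t / 2)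

theorem wrap_of_mem {t : ℝ} (ht : t ∈ Ioo (-1 : ℝ) 1) : wrap t = t := by
  have : round (t / 2) = 0 := by
    rw [round_eq, Int.floor_eq_iff]
    constructor <;> push_cast <;> linarith [ht.1, ht.2]
  simp [wrap, this]

theorem wrap_add_two (t : ℝ) : wrap (t + 2) = wrap t := by
  have : (t + 2) / 2 = t / 2 + 1 := by ring
  rw [wrap, wrap, this, round_add_one]; push_cast; ring

theorem wrap_add_two_mul (t : ℝ) (k : ℤ) : wrap (t + 2 * k) = wrap t := by
  have : (t + 2 * k) / 2 = t / 2 + k := by ring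
  rw [wrap, wrap, this, round_add_intCast]; push_cast; ring

theorem abs_wrap_le (t : ℝ) : |wrap t| ≤ 1 := by
  have := abs_sub_round (t / 2)
  have h : wrap t = 2 * (t / 2 - round (t / 2)) := by rw [wrap]; ring
  rw [h, abs_mul, abs_two]; linarith

/-- Test functions must be 2-periodic in `t`, which a function vanishing for large `|t|` need not
be. Away from odd integers `wrap` is locally a translation; near its jumps its values have modulus
at least `r`, where `p` is zero. -/
theorem contDiff_comp_wrap {p : ℝ × ℝ → ℝ} {n : WithTop ℕ∞} (hp : ContDiff ℝ n p) {r : ℝ}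
    (hr : r < 1) (h0 : ∀ ϑ t : ℝ, r ≤ |t| → p (ϑ, t) = 0) :
    ContDiff ℝ n fun z : ℝ × ℝ => p (z.1, wrap z.2) := by
  rw [contDiff_iff_contDiffAt]
  rintro ⟨a, b⟩
  set k : ℤ := round (b / 2) with hk
  have hb : |b - 2 * k| ≤ 1 := abs_wrap_le b
  rcases hb.lt_or_eq with hb | hb
  · have hev : (fun z : ℝ × ℝ => p (z.1, wrap z.2)) =ᶠ[𝓝 (a, b)]
        fun z => p (z.1, z.2 - 2 * k) := by
      have : ∀ᶠ z : ℝ × ℝ in 𝓝 (a, b), |z.2 - 2 * k| < 1 :=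
        (by fun_prop : Continuous fun z : ℝ × ℝ => |z.2 - 2 * k|).continuousAt.eventually_lt
          continuousAt_const hb
      filter_upwards [this] with z hz
      rw [← wrap_of_mem (abs_lt.1 hz), ← wrap_add_two_mul (z.2 - 2 * k) k]
      congr 2; ring_nf
    exact ((hp.comp (by fun_prop : ContDiff ℝ n fun z : ℝ × ℝ => (z.1, z.2 - 2 * (k : ℝ)))).contDiffAt
      ).congr_of_eventuallyEq hev
  · have hev : (fun z : ℝ × ℝ => p (z.1, wrap z.2)) =ᶠ[𝓝 (a, b)] fun _ => 0 := by
      have h1 : ∀ᶠ z : ℝ × ℝ in 𝓝 (a, b), |z.2 - b| < min (1 - r) 1 :=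
        (by fun_prop : Continuous fun z : ℝ × ℝ => |z.2 - b|).continuousAt.eventually_lt
          continuousAt_const (by simpa using hr)
      filter_upwards [h1] with z hz
      refine h0 _ _ ?_
      have hz1 := hz.trans_le (min_le_left _ _)
      by_contra! hlt
      have hw := abs_lt.1 hlt
      have hz' := abs_lt.1 hz1
      set m : ℤ := round (z.2 / 2) with hm
      have hwe : wrap z.2 = z.2 - 2 * m := rfl
      rw [hwe] at hw
      -- Here `b` is an odd integer. Were `z.2` within `r` of the even integer `2 * m`, then `b`
      -- would be within distance less than 1 of it, forcing `m` strictly between consecutive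
      -- integers.
      rcases (abs_eq zero_le_one).1 hb with hb | hb
      · have h1 : ((m : ℝ)) < k + 1 := by linarith [hw.1]
        have h2 : (k : ℝ) < m := by linarith [hw.2]
        norm_cast at h1 h2; omega
      · have h1 : ((m : ℝ)) < k := by linarith [hw.1]
        have h2 : (k : ℝ) < m + 1 := by linarith [hw.2]
        norm_cast at h1 h2; omega
    exact contDiffAt_const.congr_of_eventuallyEq hev

theorem dTheta_congr {F G : ℝ × ℝ → ℝ} {U : Set (ℝ × ℝ)} (hU : IsOpen U) (h : EqOn F G U) :
    EqOn (dTheta F) (dTheta G) U := by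
  intro z hz
  refine Filter.EventuallyEq.deriv_eq ?_
  have : ∀ᶠ s in 𝓝 z.1, (s, z.2) ∈ U :=
    (by fun_prop : Continuous fun s : ℝ => (s, z.2)).continuousAt.eventually (hU.mem_nhds hz)
  filter_upwards [this] with s hs using h hs

theorem dT_congr {F G : ℝ × ℝ → ℝ} {U : Set (ℝ × ℝ)} (hU : IsOpen U) (h : EqOn F G U) :
    EqOn (dT F) (dT G) U := by
  intro z hz
  refine Filter.EventuallyEq.deriv_eq ?_
  have : ∀ᶠ s in 𝓝 z.2, (z.1, s) ∈ U :=
    (by fun_prop : Continuous fun s : ℝ => (z.1, s)).continuousAt.eventually (hU.mem_nhds hz)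
  filter_upwards [this] with s hs using h hs

/-- Mollification gives smoothness and preserves periodicity in `ϑ`; composing with `wrap` then
gives periodicity in `t` without changing anything on `Omega`. -/
theorem exists_smooth_approx {p : ℝ × ℝ → ℝ} (hp : ContDiff ℝ 1 p)
    (hper : ∀ ϑ t : ℝ, p (ϑ + 2 * Real.pi, t) = p (ϑ, t)) {r : ℝ} (hr0 : 0 < r) (hr : r < 1)
    (h0 : ∀ ϑ t : ℝ, r ≤ |t| → p (ϑ, t) = 0) {ε : ℝ} (hε : 0 < ε) :
    ∃ φ, IsSmoothPerD φ ∧ ∀ z ∈ Omega, |p z - φ z| ≤ ε ∧ |dTheta p z - dTheta φ z| ≤ ε ∧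
      |dT p z - dT φ z| ≤ ε := by
  obtain ⟨δ₁, hδ₁, h₁⟩ := exists_mollify_close hp.continuous hε
  obtain ⟨δ₂, hδ₂, h₂⟩ := exists_mollify_close (continuous_dTheta hp) hε
  obtain ⟨δ₃, hδ₃, h₃⟩ := exists_mollify_close (continuous_dT hp) hε
  -- The last bound keeps the mollified function zero for `|t| ≥ (1 + r) / 2`, which is still below
  -- 1.
  set δ := min (min δ₁ δ₂) (min δ₃ ((1 - r) / 2)) with hδ
  have hδ0 : 0 < δ := by
    simp only [hδ, lt_min_iff]; exact ⟨⟨hδ₁, hδ₂⟩, hδ₃, by linarith⟩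
  have hle₁ : δ ≤ δ₁ := (min_le_left _ _).trans (min_le_left _ _)
  have hle₂ : δ ≤ δ₂ := (min_le_left _ _).trans (min_le_right _ _)
  have hle₃ : δ ≤ δ₃ := (min_le_right _ _).trans (min_le_left _ _)
  have hle₄ : δ ≤ (1 - r) / 2 := (min_le_right _ _).trans (min_le_right _ _)
  let b : ContDiffBump (0 : ℝ × ℝ) := ⟨δ / 2, δ, by linarith, by linarith⟩
  set ψ := b.normed volume with hψ
  have hψs : HasCompactSupport ψ := b.hasCompactSupport_normed
  have hψc : ContDiff ℝ ∞ ψ := b.contDiff_normed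
  set m := mollify ψ p with hm
  have hmc : ContDiff ℝ ∞ m :=
    hψs.contDiff_convolution_left _ hψc hp.continuous.locallyIntegrable
  have hm0 : ∀ ϑ t : ℝ, (1 + r) / 2 ≤ |t| → m (ϑ, t) = 0 := by
    intro ϑ t ht
    rw [hm, mollify_apply, ← integral_zero (ℝ × ℝ) ℝ (μ := volume)]
    congr 1; funext y
    by_cases hy : y ∈ Metric.ball (0 : ℝ × ℝ) δ
    · have hy2 : |y.2| < δ := by
        rw [mem_ball_zero_iff, Prod.norm_def] at hy
        exact (le_max_right _ _).trans_lt hy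
      have : p ((ϑ, t) - y) = 0 := by
        refine h0 _ _ ?_
        have := abs_sub_abs_le_abs_sub t y.2
        change r ≤ |t - y.2|; linarith
      rw [this, mul_zero]
    · have : ψ y = 0 := by
        rw [← Function.notMem_support, hψ, b.support_normed_eq]; exact hy
      rw [this, zero_mul]
  have hmper : ∀ ϑ t : ℝ, m (ϑ + 2 * Real.pi, t) = m (ϑ, t) := by
    intro ϑ t
    simp only [hm, mollify_apply]
    congr 1; funext y
    rw [show ((ϑ + 2 * Real.pi, t) - y : ℝ × ℝ) = (ϑ - y.1 + 2 * Real.pi, t - y.2) by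
      ext <;> simp; ring]
    rw [hper, show ((ϑ, t) - y : ℝ × ℝ) = (ϑ - y.1, t - y.2) from rfl]
  have heq : EqOn (fun z : ℝ × ℝ => m (z.1, wrap z.2)) m Omega := fun z hz => by
    simp only [wrap_of_mem hz.2]
  refine ⟨fun z => m (z.1, wrap z.2), ⟨⟨?_, ?_, ?_⟩, (1 + r) / 2, by linarith, by linarith, ?_⟩, ?_⟩
  · exact contDiff_comp_wrap hmc (by linarith) hm0
  · intro ϑ t; exact hmper _ _
  · intro ϑ t; simp only [wrap_add_two]
  · intro ϑ _ t ht htr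
    have h1 : (1 + r) / 2 ≤ |t| := by
      by_contra! h; exact htr (abs_lt.1 h)
    by_cases h : t ∈ Ioo (-1 : ℝ) 1
    · simp only [wrap_of_mem h]; exact hm0 _ _ h1
    · have : t = 1 ∨ t = -1 := by
        by_contra! h'
        exact h ⟨lt_of_le_of_ne ht.1 h'.2.symm, lt_of_le_of_ne ht.2 h'.1⟩
      refine hm0 _ _ ?_
      -- `round` sends half-integers upwards, so both endpoints wrap to `-1`.
      rcases this with rfl | rfl
      · have : wrap 1 = -1 := by
          have : round ((1 : ℝ) / 2) = 1 := by
            rw [round_eq, Int.floor_eq_iff]; constructor <;> norm_num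
          rw [wrap, this]; norm_num
        rw [this]; simp; linarith
      · have : wrap (-1) = -1 := by
          have : round ((-1 : ℝ) / 2) = 0 := by
            rw [round_eq, Int.floor_eq_iff]; constructor <;> norm_num
          rw [wrap, this]; norm_num
        rw [this]; simp; linarith
  · intro z hz
    rw [dTheta_congr isOpen_Omega heq hz, dT_congr isOpen_Omega heq hz, heq hz,
      dTheta_mollify hψc.continuous hψs hp, dT_mollify hψc.continuous hψs hp]
    exact ⟨h₁ b hle₁ z (subset_closure hz), h₂ b hle₂ z (subset_closure hz),
      h₃ b hle₃ z (subset_closure hz)⟩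

/-! ### Weak solutions -/

theorem IsSmoothPer.contDiff_one {φ : ℝ × ℝ → ℝ} (h : IsSmoothPer φ) : ContDiff ℝ 1 φ :=
  h.smooth.of_le (by exact_mod_cast le_top)

theorem IsSmoothPer.apply_pi {φ : ℝ × ℝ → ℝ} (h : IsSmoothPer φ) (t : ℝ) :
    φ (Real.pi, t) = φ (-Real.pi, t) := by
  rw [← h.periodic_theta (-Real.pi)]; congr 2; ring

theorem IsSmoothPer.apply_one {φ : ℝ × ℝ → ℝ} (h : IsSmoothPer φ) (ϑ : ℝ) :
    φ (ϑ, 1) = φ (ϑ, -1) := by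
  rw [← h.periodic_t ϑ (-1)]; norm_num

theorem IsSmoothPerD.apply_one {φ : ℝ × ℝ → ℝ} (h : IsSmoothPerD φ) {ϑ : ℝ}
    (hϑ : ϑ ∈ Ioo (-Real.pi) Real.pi) : φ (ϑ, 1) = 0 := by
  obtain ⟨r, _, hr, h0⟩ := h.2
  exact h0 ϑ hϑ 1 (by norm_num) fun h => by linarith [h.2]

theorem IsSmoothPerD.apply_neg_one {φ : ℝ × ℝ → ℝ} (h : IsSmoothPerD φ) {ϑ : ℝ}
    (hϑ : ϑ ∈ Ioo (-Real.pi) Real.pi) : φ (ϑ, -1) = 0 := by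
  rw [← h.1.apply_one]; exact h.apply_one hϑ

theorem MemL2per.sub {u v : ℝ × ℝ → ℝ} (hu : MemL2per u) (hv : MemL2per v) :
    MemL2per fun z => u z - v z := MemLp.sub hu hv

theorem MemL2per.integrable_sq {u : ℝ × ℝ → ℝ} (hu : MemL2per u) :
    IntegrableOn (fun z => u z ^ 2) Omega := MemLp.integrable_sq hu

theorem MemL2per.integrable_mul {u v : ℝ × ℝ → ℝ} (hu : MemL2per u) (hv : MemL2per v) :
    IntegrableOn (fun z => u z * v z) Omega := MemLp.integrable_mul hu hv

theorem h1perNorm_lt_iff {u p q : ℝ × ℝ → ℝ} {ε : ℝ} (hε : 0 < ε) :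
    h1perNorm u p q < ε ↔ (∫ z in Omega, u z ^ 2) + (∫ z in Omega, p z ^ 2) +
      (∫ z in Omega, q z ^ 2) < ε ^ 2 := by
  rw [h1perNorm, Real.sqrt_lt' hε]

theorem setIntegral_sq_nonneg (u : ℝ × ℝ → ℝ) : 0 ≤ ∫ z in Omega, u z ^ 2 :=
  integral_nonneg fun _ => sq_nonneg _

theorem MemL2per.ae_eq_zero {u : ℝ × ℝ → ℝ} (hu : MemL2per u) (h : ∫ z in Omega, u z ^ 2 ≤ 0) :
    ∀ᵐ z ∂(volume.restrict Omega), u z = 0 := by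
  have h0 := (integral_eq_zero_iff_of_nonneg (fun _ => sq_nonneg _) hu.integrable_sq).1
    (h.antisymm (setIntegral_sq_nonneg u))
  filter_upwards [h0] with z hz
  simpa using hz

/-- Functions of class `C¹`, periodic in `ϑ` and vanishing near `t = ± 1`, are in `H¹_{per,D}`. -/
theorem isH1perD_of_contDiff {p : ℝ × ℝ → ℝ} (hp : ContDiff ℝ 1 p)
    (hper : ∀ ϑ t : ℝ, p (ϑ + 2 * Real.pi, t) = p (ϑ, t)) {r : ℝ} (hr0 : 0 < r) (hr : r < 1)
    (h0 : ∀ ϑ t : ℝ, r ≤ |t| → p (ϑ, t) = 0) : IsH1perD p (dTheta p) (dT p) := by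
  refine ⟨⟨memL2per_of_continuous hp.continuous, memL2per_of_continuous (continuous_dTheta hp),
    memL2per_of_continuous (continuous_dT hp), fun φ hφ => ?_, fun φ hφ => ?_⟩, fun ε hε => ?_⟩
  · refine integral_mul_dTheta hp hφ.contDiff_one fun t _ => ?_
    rw [hφ.apply_pi, ← hper (-Real.pi)]
    congr 3; ring
  · refine integral_mul_dT hp hφ.contDiff_one fun ϑ _ => ?_
    rw [h0 ϑ 1 (by rw [abs_one]; exact hr.le), h0 ϑ (-1) (by rw [abs_neg, abs_one]; exact hr.le)]
    ring
  · set V := volume.real Omega with hV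
    have hV0 : 0 ≤ V := measureReal_nonneg
    -- With uniform error `η = ε / (3V + 1)` the squared norm is at most `3 η² V`, which is less
    -- than `η² (3V + 1)² = ε²`.
    obtain ⟨φ, hφ, hφ'⟩ := exists_smooth_approx hp hper hr0 hr h0
      (div_pos hε (by positivity : 0 < 3 * V + 1))
    set η := ε / (3 * V + 1) with hη
    have hη0 : 0 < η := by positivity
    have hεη : ε = η * (3 * V + 1) := by rw [hη]; field_simp
    have key : ∀ w : ℝ × ℝ → ℝ, (∀ z ∈ Omega, |w z| ≤ η) → ∫ z in Omega, w z ^ 2 ≤ η ^ 2 * V := by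
      intro w hw
      refine (le_abs_self _).trans ?_
      rw [← Real.norm_eq_abs]
      refine norm_setIntegral_le_of_norm_le_const ?_ fun z hz => ?_
      · exact (measure_mono subset_closure).trans_lt isCompact_closure_Omega.measure_lt_top
      · rw [Real.norm_eq_abs, abs_pow]
        exact pow_le_pow_left₀ (abs_nonneg _) (hw z hz) 2
    refine ⟨φ, hφ, (h1perNorm_lt_iff hε).2 ?_⟩
    have k1 := key _ fun z hz => (hφ' z hz).1
    have k2 := key _ fun z hz => (hφ' z hz).2.1
    have k3 := key _ fun z hz => (hφ' z hz).2.2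
    have : 3 * (η ^ 2 * V) < ε ^ 2 := by
      rw [hεη]
      nlinarith [sq_pos_of_pos hη0, mul_nonneg (sq_nonneg η) hV0,
        mul_nonneg (sq_nonneg η) (sq_nonneg V)]
    linarith

theorem IsH1perD.sub {u p q v r s : ℝ × ℝ → ℝ} (hu : IsH1perD u p q) (hv : IsH1perD v r s) :
    IsH1perD (fun z => u z - v z) (fun z => p z - r z) (fun z => q z - s z) := by
  obtain ⟨hu, hu'⟩ := hu
  obtain ⟨hv, hv'⟩ := hv
  have weak : ∀ {a b c d φ ψ : ℝ × ℝ → ℝ}, MemL2per a → MemL2per b → MemL2per c → MemL2per d →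
      MemL2per φ → MemL2per ψ → ∫ z in Omega, a z * ψ z = - ∫ z in Omega, b z * φ z →
      ∫ z in Omega, c z * ψ z = - ∫ z in Omega, d z * φ z →
      ∫ z in Omega, (a z - c z) * ψ z = - ∫ z in Omega, (b z - d z) * φ z := by
    intro a b c d φ ψ ha hb hc hd hφ hψ h1 h2
    simp_rw [sub_mul]
    rw [integral_sub (ha.integrable_mul hψ) (hc.integrable_mul hψ),
      integral_sub (hb.integrable_mul hφ) (hd.integrable_mul hφ), h1, h2]
    ring
  refine ⟨⟨hu.memL2.sub hv.memL2, hu.memL2_theta.sub hv.memL2_theta, hu.memL2_t.sub hv.memL2_t,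
    fun φ hφ => ?_, fun φ hφ => ?_⟩, fun ε hε => ?_⟩
  · exact weak hu.memL2 hu.memL2_theta hv.memL2 hv.memL2_theta
      (memL2per_of_continuous hφ.contDiff_one.continuous)
      (memL2per_of_continuous (continuous_dTheta hφ.contDiff_one))
      (hu.weak_theta φ hφ) (hv.weak_theta φ hφ)
  · exact weak hu.memL2 hu.memL2_t hv.memL2 hv.memL2_t
      (memL2per_of_continuous hφ.contDiff_one.continuous)
      (memL2per_of_continuous (continuous_dT hφ.contDiff_one))
      (hu.weak_t φ hφ) (hv.weak_t φ hφ)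
  · obtain ⟨φ, hφ, h1⟩ := hu' (ε / 2) (by positivity)
    obtain ⟨ψ, hψ, h2⟩ := hv' (ε / 2) (by positivity)
    have cφ := hφ.1.contDiff_one
    have cψ := hψ.1.contDiff_one
    have hdΘ : dTheta (fun z => φ z - ψ z) = fun z => dTheta φ z - dTheta ψ z :=
      funext fun z => ((hasDerivAt_dTheta cφ z).sub (hasDerivAt_dTheta cψ z)).deriv
    have hdT : dT (fun z => φ z - ψ z) = fun z => dT φ z - dT ψ z :=
      funext fun z => ((hasDerivAt_dT cφ z).sub (hasDerivAt_dT cψ z)).deriv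
    refine ⟨fun z => φ z - ψ z, ⟨⟨hφ.1.smooth.sub hψ.1.smooth, fun ϑ t => ?_, fun ϑ t => ?_⟩, ?_⟩, ?_⟩
    · simp only [hφ.1.periodic_theta, hψ.1.periodic_theta]
    · simp only [hφ.1.periodic_t, hψ.1.periodic_t]
    · obtain ⟨a, ha0, ha1, ha⟩ := hφ.2
      obtain ⟨b, hb0, hb1, hb⟩ := hψ.2
      refine ⟨max a b, lt_max_of_lt_left ha0, max_lt ha1 hb1, fun ϑ hϑ t ht hn => ?_⟩
      have m1 := le_max_left a b
      have m2 := le_max_right a b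
      change φ (ϑ, t) - ψ (ϑ, t) = 0
      rw [ha ϑ hϑ t ht fun h => hn ⟨by linarith [h.1], by linarith [h.2]⟩,
        hb ϑ hϑ t ht fun h => hn ⟨by linarith [h.1], by linarith [h.2]⟩, sub_zero]
    · rw [h1perNorm_lt_iff (by positivity)] at h1 h2 ⊢
      have key : ∀ {a b c d : ℝ × ℝ → ℝ}, MemL2per a → MemL2per b → MemL2per c → MemL2per d →
          ∫ z in Omega, ((a z - c z) - (b z - d z)) ^ 2 ≤
            2 * (∫ z in Omega, (a z - b z) ^ 2) + 2 * ∫ z in Omega, (c z - d z) ^ 2 := by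
        intro a b c d ha hb hc hd
        rw [← integral_const_mul, ← integral_const_mul, ← integral_add
          ((ha.sub hb).integrable_sq.const_mul 2) ((hc.sub hd).integrable_sq.const_mul 2)]
        refine integral_mono ((ha.sub hc).sub (hb.sub hd)).integrable_sq
          (((ha.sub hb).integrable_sq.const_mul 2).add ((hc.sub hd).integrable_sq.const_mul 2))
          fun z => ?_
        nlinarith [sq_nonneg ((a z - b z) + (c z - d z))]
      rw [hdΘ, hdT]
      have k1 := key hu.memL2 (memL2per_of_continuous cφ.continuous) hv.memL2
        (memL2per_of_continuous cψ.continuous)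
      have k2 := key hu.memL2_theta (memL2per_of_continuous (continuous_dTheta cφ)) hv.memL2_theta
        (memL2per_of_continuous (continuous_dTheta cψ))
      have k3 := key hu.memL2_t (memL2per_of_continuous (continuous_dT cφ)) hv.memL2_t
        (memL2per_of_continuous (continuous_dT cψ))
      have : ε ^ 2 = 2 * (ε / 2) ^ 2 + 2 * (ε / 2) ^ 2 := by ring
      linarith

/-- The Poincaré inequality in the variable `t`. -/
theorem IsSmoothPerD.poincare {φ : ℝ × ℝ → ℝ} (hφ : IsSmoothPerD φ) :
    ∫ z in Omega, φ z ^ 2 ≤ 4 * ∫ z in Omega, dT φ z ^ 2 := by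
  have c := hφ.1.contDiff_one
  have hsnd : ContDiff ℝ 1 (fun z : ℝ × ℝ => z.2) := contDiff_snd
  have cF : ContDiff ℝ 1 fun z : ℝ × ℝ => φ z * φ z := c.mul c
  -- The weight `t` has derivative 1, so integration by parts turns `∫ φ²` into `-2 ∫ t φ ∂_t φ`.
  -- Since `|t| ≤ 1`, Young's inequality bounds this by `1/2 ∫ φ² + 2 ∫ (∂_t φ)²`; absorbing the
  -- first term gives the constant 4.
  have h := integral_mul_dT cF hsnd fun ϑ hϑ => by
    simp only [hφ.apply_one hϑ, hφ.apply_neg_one hϑ]; ring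
  have hd : ∀ z : ℝ × ℝ, dT (fun z : ℝ × ℝ => z.2) z = 1 := fun z => by simp [dT]
  simp_rw [dT_mul c c, hd, mul_one] at h
  have m1 := memL2per_of_continuous c.continuous
  have m2 := memL2per_of_continuous (continuous_dT c)
  have hle : - ∫ z in Omega, (dT φ z * φ z + φ z * dT φ z) * z.2 ≤
      ∫ z in Omega, (1 / 2 * φ z ^ 2 + 2 * dT φ z ^ 2) := by
    rw [← integral_neg]
    refine setIntegral_mono_on ?_ ?_ measurableSet_Omega fun z hz => ?_
    · have := c.continuous
      have := continuous_dT c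
      exact integrableOn_Omega (by fun_prop)
    · exact (m1.integrable_sq.const_mul _).add (m2.integrable_sq.const_mul _)
    · have h2 : z.2 ^ 2 ≤ 1 := by
        have h1 := hz.2.1
        have h1' := hz.2.2
        nlinarith
      have hz2 : (z.2 * φ z) ^ 2 ≤ φ z ^ 2 := by
        rw [mul_pow]; nlinarith [sq_nonneg (φ z)]
      nlinarith [sq_nonneg (z.2 * φ z + 2 * dT φ z)]
  rw [← h, integral_add (m1.integrable_sq.const_mul _) (m2.integrable_sq.const_mul _),
    integral_const_mul, integral_const_mul] at hle
  simp_rw [← sq] at hle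
  linarith

/-- The Poincaré inequality passes to the closure: if `q` vanishes, approximants of `w` have small
`t`-derivative, hence are small in `L²` themselves. -/
theorem IsH1perD.ae_eq_zero {w p q : ℝ × ℝ → ℝ} (h : IsH1perD w p q)
    (hq : ∀ᵐ z ∂(volume.restrict Omega), q z = 0) :
    ∀ᵐ z ∂(volume.restrict Omega), w z = 0 := by
  obtain ⟨hw, happ⟩ := h
  refine hw.memL2.ae_eq_zero (le_of_forall_pos_le_add fun ε hε => ?_)
  -- The final bound is `2 ‖w - φ‖² + 2 · 4 ‖q - ∂_t φ‖²`, so a squared error below `ε / 10` is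
  -- ample.
  obtain ⟨φ, hφ, hlt⟩ := happ (Real.sqrt (ε / 10)) (by positivity)
  rw [h1perNorm_lt_iff (by positivity), Real.sq_sqrt (by positivity)] at hlt
  have c := hφ.1.contDiff_one
  have m1 := memL2per_of_continuous c.continuous
  have hP := hφ.poincare
  have hq' : ∫ z in Omega, dT φ z ^ 2 = ∫ z in Omega, (q z - dT φ z) ^ 2 := by
    refine integral_congr_ae ?_
    filter_upwards [hq] with z hz
    rw [hz]; ring
  have h1 : ∫ z in Omega, w z ^ 2 ≤
      2 * (∫ z in Omega, (w z - φ z) ^ 2) + 2 * ∫ z in Omega, φ z ^ 2 := by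
    rw [← integral_const_mul, ← integral_const_mul, ← integral_add
      ((hw.memL2.sub m1).integrable_sq.const_mul 2) (m1.integrable_sq.const_mul 2)]
    refine integral_mono hw.memL2.integrable_sq
      (((hw.memL2.sub m1).integrable_sq.const_mul 2).add (m1.integrable_sq.const_mul 2))
      fun z => ?_
    nlinarith [sq_nonneg (w z - φ z - φ z)]
  have n1 := setIntegral_sq_nonneg fun z => p z - dTheta φ z
  have n2 := setIntegral_sq_nonneg fun z => w z - φ z
  have n3 := setIntegral_sq_nonneg fun z => q z - dT φ z
  rw [hq'] at hP
  linarith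

/-- Testing both equations with the difference of the solutions shows that its weak gradient has
zero `L²` norm. -/
theorem IsWeakSolution.ae_eq {g u₁ u₂ : ℝ × ℝ → ℝ} (h₁ : IsWeakSolution g u₁)
    (h₂ : IsWeakSolution g u₂) : u₁ =ᵐ[volume.restrict Omega] u₂ := by
  obtain ⟨p₁, q₁, H₁, e₁⟩ := h₁
  obtain ⟨p₂, q₂, H₂, e₂⟩ := h₂
  have H := H₁.sub H₂
  have E := (e₁ _ _ _ H).trans (e₂ _ _ _ H).symm
  have a1 := H₁.1.memL2_theta
  have a2 := H₁.1.memL2_t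
  have b1 := H₂.1.memL2_theta
  have b2 := H₂.1.memL2_t
  have hI : (∫ z in Omega, (p₁ z - p₂ z) ^ 2) + ∫ z in Omega, (q₁ z - q₂ z) ^ 2 = 0 := by
    rw [← integral_add (a1.sub b1).integrable_sq (a2.sub b2).integrable_sq, ← sub_eq_zero.2 E,
      ← integral_sub ((a1.integrable_mul (a1.sub b1)).fun_add (a2.integrable_mul (a2.sub b2)))
        ((b1.integrable_mul (a1.sub b1)).fun_add (b2.integrable_mul (a2.sub b2)))]
    congr 1; funext z; ring
  have n1 := setIntegral_sq_nonneg fun z => p₁ z - p₂ z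
  have hq := (a2.sub b2).ae_eq_zero (by linarith)
  filter_upwards [H.ae_eq_zero hq] with z hz using sub_eq_zero.1 hz

/-- For smooth test functions the boundary terms cancel in `ϑ` by periodicity and vanish at `t = ±
1` because the test function does; both sides are continuous in the `H¹` norm. -/
theorem integral_grad_mul {p : ℝ × ℝ → ℝ} (hp : ContDiff ℝ 2 p)
    (hper : ∀ ϑ t : ℝ, p (ϑ + 2 * Real.pi, t) = p (ϑ, t)) {v r s : ℝ × ℝ → ℝ}
    (hv : IsH1perD v r s) :
    ∫ z in Omega, (dTheta p z * r z + dT p z * s z) = - ∫ z in Omega, v z * laplace p z := by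
  obtain ⟨hv, happ⟩ := hv
  have hp1 : ContDiff ℝ 1 p := hp.of_le (by norm_num)
  have m1 := memL2per_of_continuous (continuous_dTheta hp1)
  have m2 := memL2per_of_continuous (continuous_dT hp1)
  have m3 := memL2per_of_continuous (continuous_laplace hp)
  have hsplit : ∀ {a b c : ℝ × ℝ → ℝ}, MemL2per a → MemL2per b → MemL2per c →
      ∫ z in Omega, (dTheta p z * b z + dT p z * c z + a z * laplace p z) =
        (∫ z in Omega, (dTheta p z * b z + dT p z * c z)) + ∫ z in Omega, a z * laplace p z :=
    fun ha hb hc => integral_add ((m1.integrable_mul hb).add (m2.integrable_mul hc))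
      (ha.integrable_mul m3)
  have hint : ∀ {a b c : ℝ × ℝ → ℝ}, MemL2per a → MemL2per b → MemL2per c →
      IntegrableOn (fun z => dTheta p z * b z + dT p z * c z + a z * laplace p z) Omega :=
    fun ha hb hc => ((m1.integrable_mul hb).add (m2.integrable_mul hc)).add
      (ha.integrable_mul m3)
  have hsmooth : ∀ φ, IsSmoothPerD φ →
      ∫ z in Omega, (dTheta p z * dTheta φ z + dT p z * dT φ z + φ z * laplace p z) = 0 := by
    intro φ hφ
    have c := hφ.1.contDiff_one
    have n1 := memL2per_of_continuous (continuous_dTheta c)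
    have n2 := memL2per_of_continuous (continuous_dT c)
    have n3 := memL2per_of_continuous c.continuous
    have m4 := memL2per_of_continuous (continuous_dTheta (contDiff_dTheta hp))
    have m5 := memL2per_of_continuous (continuous_dT (contDiff_dT hp))
    have hpθ : ∀ t, dTheta p (Real.pi, t) = dTheta p (-Real.pi, t) := by
      intro t
      have : (fun s => p (s, t)) = fun s => p (s + 2 * Real.pi, t) := by funext s; rw [hper]
      simp only [dTheta]
      conv_rhs => rw [this]
      rw [deriv_comp_add_const (f := fun s => p (s, t))]
      congr 1; ring
    rw [hsplit n3 n1 n2, integral_add (m1.integrable_mul n1) (m2.integrable_mul n2),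
      integral_mul_dTheta (contDiff_dTheta hp) c fun t _ => by rw [hφ.1.apply_pi, hpθ],
      integral_mul_dT (contDiff_dT hp) c fun ϑ hϑ => by
        rw [hφ.apply_one hϑ, hφ.apply_neg_one hϑ, mul_zero, mul_zero],
      ← neg_add, ← integral_add (m4.integrable_mul n3) (m5.integrable_mul n3), neg_add_eq_zero]
    congr 1; funext z; simp only [laplace]; ring
  set D := ∫ z in Omega, (dTheta p z * r z + dT p z * s z + v z * laplace p z) with hD
  set A := (∫ z in Omega, dTheta p z ^ 2) + (∫ z in Omega, dT p z ^ 2) +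
    ∫ z in Omega, laplace p z ^ 2 with hA
  have hA0 : 0 ≤ A := add_nonneg (add_nonneg (setIntegral_sq_nonneg _) (setIntegral_sq_nonneg _))
    (setIntegral_sq_nonneg _)
  -- The defect `D` is linear in the test function and zero on smooth ones, so an `η`-close `φ` may
  -- be subtracted. Young's inequality with weight `η` gives `η A / 2 + η² / (2η)`.
  have hbound : ∀ η > 0, |D| ≤ η * (A + 1) / 2 := by
    intro η hη
    obtain ⟨φ, hφ, hlt⟩ := happ η hη
    rw [h1perNorm_lt_iff hη] at hlt
    have c := hφ.1.contDiff_one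
    have n1 := memL2per_of_continuous (continuous_dTheta c)
    have n2 := memL2per_of_continuous (continuous_dT c)
    have n3 := memL2per_of_continuous c.continuous
    have d1 := hv.memL2_theta.sub n1
    have d2 := hv.memL2_t.sub n2
    have d3 := hv.memL2.sub n3
    have hDe : D = ∫ z in Omega, (dTheta p z * (r z - dTheta φ z) + dT p z * (s z - dT φ z) +
        (v z - φ z) * laplace p z) := by
      rw [← sub_zero D, ← hsmooth φ hφ, hD,
        ← integral_sub (hint hv.memL2 hv.memL2_theta hv.memL2_t) (hint n3 n1 n2)]
      congr 1; funext z; ring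
    have i1 := m1.integrable_sq
    have i2 := m2.integrable_sq
    have i3 := m3.integrable_sq
    have j1 := d1.integrable_sq
    have j2 := d2.integrable_sq
    have j3 := d3.integrable_sq
    have hle : |D| ≤ ∫ z in Omega, (η / 2 * (dTheta p z ^ 2 + dT p z ^ 2 + laplace p z ^ 2) +
        1 / (2 * η) * ((v z - φ z) ^ 2 + (r z - dTheta φ z) ^ 2 + (s z - dT φ z) ^ 2)) := by
      rw [hDe, ← Real.norm_eq_abs]
      refine norm_integral_le_of_norm_le ((((i1.fun_add i2).fun_add i3).const_mul _).fun_add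
        (((j3.fun_add j1).fun_add j2).const_mul _)) (Eventually.of_forall fun z => ?_)
      have young : ∀ a b : ℝ, |a * b| ≤ η / 2 * a ^ 2 + 1 / (2 * η) * b ^ 2 := by
        intro a b
        have e : η / 2 * a ^ 2 + 1 / (2 * η) * b ^ 2 - |a * b| =
            1 / (2 * η) * (η * |a| - |b|) ^ 2 := by
          rw [abs_mul, ← sq_abs a, ← sq_abs b]; field_simp; ring
        have : 0 ≤ 1 / (2 * η) * (η * |a| - |b|) ^ 2 := by positivity
        linarith
      rw [Real.norm_eq_abs]
      refine (abs_add_three _ _ _).trans ?_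
      have y1 := young (dTheta p z) (r z - dTheta φ z)
      have y2 := young (dT p z) (s z - dT φ z)
      have y3 := young (laplace p z) (v z - φ z)
      rw [mul_comm (laplace p z)] at y3
      linarith
    rw [integral_add (((i1.fun_add i2).fun_add i3).const_mul _) (((j3.fun_add j1).fun_add j2).const_mul _),
      integral_const_mul, integral_const_mul, integral_add (i1.fun_add i2) i3, integral_add i1 i2,
      integral_add (j3.fun_add j1) j2, integral_add j3 j1, ← hA] at hle
    refine hle.trans ?_
    have : 1 / (2 * η) * ((∫ z in Omega, (v z - φ z) ^ 2) + (∫ z in Omega, (r z - dTheta φ z) ^ 2) +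
        ∫ z in Omega, (s z - dT φ z) ^ 2) ≤ 1 / (2 * η) * η ^ 2 :=
      mul_le_mul_of_nonneg_left hlt.le (by positivity)
    have e : 1 / (2 * η) * η ^ 2 = η / 2 := by field_simp
    rw [e] at this
    linarith
  have hD0 : D = 0 := by
    rw [← abs_nonpos_iff]
    refine le_of_forall_pos_le_add fun ε hε => ?_
    have := hbound (ε / (A + 1)) (by positivity)
    rw [div_mul_cancel₀ _ (by positivity)] at this
    linarith
  rw [hD, hsplit hv.memL2 hv.memL2_theta hv.memL2_t] at hD0
  linarith

theorem isWeakSolution_laplace {p : ℝ × ℝ → ℝ} (hp : ContDiff ℝ 2 p)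
    (hper : ∀ ϑ t : ℝ, p (ϑ + 2 * Real.pi, t) = p (ϑ, t)) {r : ℝ} (hr0 : 0 < r) (hr : r < 1)
    (h0 : ∀ ϑ t : ℝ, r ≤ |t| → p (ϑ, t) = 0) : IsWeakSolution (laplace p) p :=
  ⟨dTheta p, dT p, isH1perD_of_contDiff (hp.of_le (by norm_num)) hper hr0 hr h0,
    fun _ _ _ hv => integral_grad_mul hp hper hv⟩

/-! ### The right-hand side -/

theorem exists_pi_div_mul_modulo {lam : ℝ} (hlam : 0 < lam) (t : ℝ) :
    ∃ k : ℤ, Real.pi / lam * modulo lam t = Real.pi / lam * t - k * (2 * Real.pi) :=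
  ⟨⌊(t + lam) / (2 * lam)⌋, by rw [modulo]; field_simp⟩

theorem sinPhase_moduloRadon {lam : ℝ} (hlam : 0 < lam) (f : Plane → ℝ) :
    sinPhase lam (moduloRadon lam f) = sinPhase lam (radon f) := by
  funext z
  obtain ⟨k, hk⟩ := exists_pi_div_mul_modulo hlam (radon f z)
  rw [sinPhase, moduloRadon, hk, Real.sin_sub_int_mul_two_pi, sinPhase]

theorem cosPhase_moduloRadon {lam : ℝ} (hlam : 0 < lam) (f : Plane → ℝ) :
    cosPhase lam (moduloRadon lam f) = cosPhase lam (radon f) := by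
  funext z
  obtain ⟨k, hk⟩ := exists_pi_div_mul_modulo hlam (radon f z)
  rw [cosPhase, moduloRadon, hk, Real.cos_sub_int_mul_two_pi, cosPhase]

theorem poissonRhs_moduloRadon {lam : ℝ} (hlam : 0 < lam) (f : Plane → ℝ) :
    poissonRhs lam (moduloRadon lam f) = poissonRhs lam (radon f) := by
  funext z
  simp only [poissonRhs, sinPhase_moduloRadon hlam, cosPhase_moduloRadon hlam]

theorem poissonRhs_eq_laplace {lam : ℝ} (hlam : 0 < lam) {p : ℝ × ℝ → ℝ} (hp : ContDiff ℝ 2 p) :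
    poissonRhs lam p = laplace p := by
  have hp1 : ContDiff ℝ 1 p := hp.of_le (by norm_num)
  set c := Real.pi / lam with hc
  have hc0 : c ≠ 0 := by positivity
  have sΘ : dTheta (sinPhase lam p) = fun z => Real.cos (c * p z) * (c * dTheta p z) :=
    funext fun z => ((hasDerivAt_dTheta hp1 z).const_mul c).sin.deriv
  have cΘ : dTheta (cosPhase lam p) = fun z => -Real.sin (c * p z) * (c * dTheta p z) :=
    funext fun z => ((hasDerivAt_dTheta hp1 z).const_mul c).cos.deriv
  have sT : dT (sinPhase lam p) = fun z => Real.cos (c * p z) * (c * dT p z) :=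
    funext fun z => ((hasDerivAt_dT hp1 z).const_mul c).sin.deriv
  have cT : dT (cosPhase lam p) = fun z => -Real.sin (c * p z) * (c * dT p z) :=
    funext fun z => ((hasDerivAt_dT hp1 z).const_mul c).cos.deriv
  funext z
  have a1 := hasDerivAt_dTheta hp1 z
  have a2 := hasDerivAt_dTheta (contDiff_dTheta hp) z
  have b1 := hasDerivAt_dT hp1 z
  have b2 := hasDerivAt_dT (contDiff_dT hp) z
  have fTheta : dTheta (dTheta (sinPhase lam p)) z = -Real.sin (c * p z) * (c * dTheta p z) * (c * dTheta p z) +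
      Real.cos (c * p z) * (c * dTheta (dTheta p) z) := by
    rw [sΘ]; exact ((a1.const_mul c).cos.mul (a2.const_mul c)).deriv
  have gTheta : dTheta (dTheta (cosPhase lam p)) z = -(Real.cos (c * p z) * (c * dTheta p z)) * (c * dTheta p z) +
      -Real.sin (c * p z) * (c * dTheta (dTheta p) z) := by
    rw [cΘ]; exact ((a1.const_mul c).sin.neg.mul (a2.const_mul c)).deriv
  have fT : dT (dT (sinPhase lam p)) z = -Real.sin (c * p z) * (c * dT p z) * (c * dT p z) +
      Real.cos (c * p z) * (c * dT (dT p) z) := by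
    rw [sT]; exact ((b1.const_mul c).cos.mul (b2.const_mul c)).deriv
  have gT : dT (dT (cosPhase lam p)) z = -(Real.cos (c * p z) * (c * dT p z)) * (c * dT p z) +
      -Real.sin (c * p z) * (c * dT (dT p) z) := by
    rw [cT]; exact ((b1.const_mul c).sin.neg.mul (b2.const_mul c)).deriv
  rw [poissonRhs, laplace, laplace, fTheta, gTheta, fT, gT, sinPhase, cosPhase, laplace, ← hc,
    show lam / Real.pi = c⁻¹ by rw [hc, inv_div]]
  have h := Real.sin_sq_add_cos_sq (c * p z)
  field_simp
  linear_combination (dTheta (dTheta p) z + dT (dT p) z) * h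

/-! ### The Radon transform of a function supported in the unit ball -/

theorem norm_sq_line (ϑ t s : ℝ) :
    ‖(!₂[t * Real.cos ϑ - s * Real.sin ϑ, t * Real.sin ϑ + s * Real.cos ϑ] : Plane)‖ ^ 2 =
      t ^ 2 + s ^ 2 := by
  rw [EuclideanSpace.norm_sq_eq]
  simp only [Fin.sum_univ_two, Real.norm_eq_abs, sq_abs, Matrix.cons_val_zero,
    Matrix.cons_val_one]
  linear_combination (t ^ 2 + s ^ 2) * Real.sin_sq_add_cos_sq ϑ

theorem radon_eq_zero {f : Plane → ℝ} {r : ℝ} (h0 : ∀ x, r ≤ ‖x‖ → f x = 0) (ϑ t : ℝ)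
    (ht : r ≤ |t|) : radon f (ϑ, t) = 0 := by
  rw [radon, ← integral_zero ℝ ℝ (μ := volume)]
  congr 1; funext s
  refine h0 _ (ht.trans (abs_le_of_sq_le_sq ?_ (norm_nonneg _)))
  rw [norm_sq_line]
  linarith [sq_nonneg s]

theorem radon_add_two_pi (f : Plane → ℝ) (ϑ t : ℝ) :
    radon f (ϑ + 2 * Real.pi, t) = radon f (ϑ, t) := by
  simp only [radon, Real.cos_add_two_pi, Real.sin_add_two_pi]

/-- Both parameter pairs describe the same line, traversed in opposite directions. -/
theorem radon_add_pi_neg (f : Plane → ℝ) (ϑ t : ℝ) :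
    radon f (ϑ + Real.pi, -t) = radon f (ϑ, t) := by
  simp only [radon, Real.cos_add_pi, Real.sin_add_pi]
  rw [← integral_neg_eq_self]
  congr 1; funext s; congr 3 <;> ring_nf

theorem radon_sub_int_mul_two_pi (f : Plane → ℝ) (ϑ t : ℝ) (k : ℤ) :
    radon f (ϑ - k * (2 * Real.pi), t) = radon f (ϑ, t) := by
  simp only [radon, Real.cos_sub_int_mul_two_pi, Real.sin_sub_int_mul_two_pi]

/-- Symmetries carry every point with `|t| < 1` into the open rectangle: a multiple of `2π` suffices
unless the reduced angle is `π`, where the reflection `(ϑ, t) ↦ (ϑ - π, -t)` moves it to angle 0.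
Near `|t| ≥ 1` the transform is zero. -/
theorem contDiff_radon {f : Plane → ℝ} {n : WithTop ℕ∞} {r : ℝ} (hr : r < 1)
    (h0 : ∀ x, r ≤ ‖x‖ → f x = 0) (hR : ContDiffOn ℝ n (radon f) (closure Omega)) :
    ContDiff ℝ n (radon f) := by
  have hpi := Real.pi_pos
  have hint : ∀ z ∈ Omega, ContDiffAt ℝ n (radon f) z := fun z hz =>
    (hR z (subset_closure hz)).contDiffAt (mem_of_superset (isOpen_Omega.mem_nhds hz) subset_closure)
  rw [contDiff_iff_contDiffAt]
  rintro ⟨a, b⟩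
  by_cases hb : |b| < 1
  · obtain ⟨hb1, hb2⟩ := abs_lt.1 hb
    set k := toIocDiv (by positivity : 0 < 2 * Real.pi) (-Real.pi) a with hk
    have ha := sub_toIocDiv_zsmul_mem_Ioc (by positivity : 0 < 2 * Real.pi) (-Real.pi) a
    rw [← hk, zsmul_eq_mul] at ha
    by_cases hπ : a - k * (2 * Real.pi) = Real.pi
    · have e : radon f = fun z => radon f (z.1 - k * (2 * Real.pi) - Real.pi, -z.2) := by
        funext z
        rw [← radon_add_pi_neg f (z.1 - _ - _), sub_add_cancel, neg_neg, radon_sub_int_mul_two_pi]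
      rw [e]
      refine ContDiffAt.comp (a, b) (g := radon f)
        (f := fun z : ℝ × ℝ => (z.1 - k * (2 * Real.pi) - Real.pi, -z.2)) (hint _ ?_) (by fun_prop)
      simp only [hπ, sub_self]
      exact ⟨⟨by linarith, hpi⟩, by linarith, by linarith⟩
    · have e : radon f = fun z => radon f (z.1 - k * (2 * Real.pi), z.2) := by
        funext z
        rw [radon_sub_int_mul_two_pi]
      rw [e]
      refine ContDiffAt.comp (a, b) (g := radon f)
        (f := fun z : ℝ × ℝ => (z.1 - k * (2 * Real.pi), z.2)) (hint _ ?_) (by fun_prop)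
      exact ⟨⟨ha.1, lt_of_le_of_ne (by linarith [ha.2]) hπ⟩, hb1, hb2⟩
  · have hev : radon f =ᶠ[𝓝 (a, b)] fun _ => 0 := by
      have : ∀ᶠ z : ℝ × ℝ in 𝓝 (a, b), r < |z.2| :=
        continuousAt_const.eventually_lt (by fun_prop : Continuous fun z : ℝ × ℝ => |z.2|).continuousAt
          (by simp only; linarith)
      filter_upwards [this] with z hz using radon_eq_zero h0 z.1 z.2 hz.le
    exact contDiffAt_const.congr_of_eventuallyEq hev

/-! ### Coordinates of the plane -/

/-- The direction `(cos ϑ, sin ϑ)`. -/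
noncomputable def direction (ϑ : ℝ) : Plane := !₂[Real.cos ϑ, Real.sin ϑ]

/-- The rotation of the plane by the angle `ϑ`. -/
noncomputable def rotation (ϑ : ℝ) : Plane ≃ₗᵢ[ℝ] Plane :=
  LinearIsometry.toLinearIsometryEquiv
    { toFun := fun v => !₂[v 0 * Real.cos ϑ - v 1 * Real.sin ϑ, v 0 * Real.sin ϑ + v 1 * Real.cos ϑ]
      map_add' := fun v w => by ext i; fin_cases i <;> simp <;> ring
      map_smul' := fun c v => by ext i; fin_cases i <;> simp <;> ring
      norm_map' := fun v => by
        have h := norm_sq_line ϑ (v 0) (v 1)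
        rw [← Real.sqrt_sq (norm_nonneg v), EuclideanSpace.norm_sq_eq,
          ← Real.sqrt_sq (norm_nonneg _)]
        congr 1
        simpa [Fin.sum_univ_two] using h } rfl

/-- The coordinates `(t, s) ↦ t (cos ϑ, sin ϑ) + s (- sin ϑ, cos ϑ)` of the plane. -/
noncomputable def rotatedCoords (ϑ : ℝ) : ℝ × ℝ ≃ᵐ Plane :=
  MeasurableEquiv.finTwoArrow.symm.trans
    ((MeasurableEquiv.toLp 2 (Fin 2 → ℝ)).trans (rotation ϑ).toMeasurableEquiv)

theorem rotatedCoords_apply (ϑ t s : ℝ) : rotatedCoords ϑ (t, s) =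
    !₂[t * Real.cos ϑ - s * Real.sin ϑ, t * Real.sin ϑ + s * Real.cos ϑ] := rfl

theorem measurePreserving_rotatedCoords (ϑ : ℝ) :
    MeasurePreserving (rotatedCoords ϑ) volume volume :=
  ((rotation ϑ).measurePreserving.comp (PiLp.volume_preserving_toLp (Fin 2))).comp
    ((volume_preserving_finTwoArrow ℝ).symm)

theorem fourierChar_neg_mul (t S : ℝ) :
    (Real.fourierChar (-(S / (2 * Real.pi) * t)) : ℂ) = Complex.exp (-(Complex.I * S * t)) := by
  have : (Real.pi : ℂ) ≠ 0 := by exact_mod_cast Real.pi_ne_zero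
  rw [Real.fourierChar_apply]
  congr 1; push_cast; field_simp

/-- The Fourier slice theorem. -/
theorem integral_radon_mul_exp {f : Plane → ℝ} (hf : Integrable fun x => (f x : ℂ)) (ϑ S : ℝ) :
    ∫ t : ℝ, (radon f (ϑ, t) : ℂ) * Complex.exp (-(Complex.I * S * t)) =
      𝓕 (fun x : Plane => (f x : ℂ)) ((S / (2 * Real.pi)) • direction ϑ) := by
  have hmp := measurePreserving_rotatedCoords ϑ
  have hI : Integrable fun v : Plane => Real.fourierChar
      (-inner ℝ v ((S / (2 * Real.pi)) • direction ϑ)) • (f v : ℂ) :=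
    (Real.fourierIntegral_convergent_iff _).2 hf
  rw [Real.fourier_eq, ← hmp.integral_comp']
  have hI' := (hmp.integrable_comp_emb (rotatedCoords ϑ).measurableEmbedding).2 hI
  rw [Measure.volume_eq_prod] at hI' ⊢
  refine Eq.trans ?_ (integral_prod _ hI').symm
  congr 1; funext t
  -- The phase is constant along each line of integration, so the inner integral is the Radon
  -- transform. The factor `1 / (2π)` matches `e^{-iSt}` to the `e^{-2πi}` convention of `𝓕`.
  have hin : ∀ s : ℝ, inner ℝ (rotatedCoords ϑ (t, s)) ((S / (2 * Real.pi)) • direction ϑ) =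
      S / (2 * Real.pi) * t := by
    intro s
    rw [inner_smul_right, rotatedCoords_apply, direction, PiLp.inner_apply, Fin.sum_univ_two]
    simp
    left
    linear_combination t * Real.sin_sq_add_cos_sq ϑ
  simp_rw [Function.comp_apply, hin, Circle.smul_def, fourierChar_neg_mul, smul_eq_mul]
  rw [integral_const_mul, mul_comm]
  congr 1
  exact (integral_ofReal (𝕜 := ℂ)).symm

/-! ### Polar coordinates with signed radius -/

theorem integrableOn_polarCoord_symm {g : ℝ × ℝ → ℂ} (hg : Integrable g) :
    IntegrableOn (fun p : ℝ × ℝ => p.1 • g (polarCoord.symm p)) polarCoord.target := by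
  have h := (integrableOn_image_iff_integrableOn_abs_det_fderiv_smul volume
    polarCoord.open_target.measurableSet
    (fun p _ => (hasFDerivAt_polarCoord_symm p).hasFDerivWithinAt) polarCoord.symm.injOn g).1
    hg.integrableOn
  refine h.congr_fun (fun p hp => ?_) polarCoord.open_target.measurableSet
  have : 0 < p.1 := by rw [polarCoord_target] at hp; exact hp.1
  simp only [det_fderivPolarCoordSymm, abs_of_pos this]

/-- The weight is written `|p.1|` so that the same integrand serves for negative radii. -/
theorem polar_half {G : Plane → ℂ} (hG : Integrable G) :
    IntegrableOn (fun p : ℝ × ℝ => (|p.1| : ℝ) • G (p.1 • direction p.2))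
      (Ioi 0 ×ˢ Ioo (-Real.pi) Real.pi) ∧
    ∫ p in Ioi (0 : ℝ) ×ˢ Ioo (-Real.pi) Real.pi, (|p.1| : ℝ) • G (p.1 • direction p.2) =
      ∫ x, G x := by
  have hmp := measurePreserving_rotatedCoords 0
  set g : ℝ × ℝ → ℂ := fun p => G (rotatedCoords 0 p) with hg
  have hgi : Integrable g := (hmp.integrable_comp_emb (rotatedCoords 0).measurableEmbedding).2 hG
  have heq : EqOn (fun p : ℝ × ℝ => p.1 • g (polarCoord.symm p))
      (fun p : ℝ × ℝ => (|p.1| : ℝ) • G (p.1 • direction p.2))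
      (Ioi 0 ×ˢ Ioo (-Real.pi) Real.pi) := by
    intro p hp
    have : 0 < p.1 := hp.1
    simp only [abs_of_pos this, hg, polarCoord_symm_apply, rotatedCoords_apply]
    congr 2
    ext i; fin_cases i <;> simp [direction]
  have hm : MeasurableSet (Ioi (0 : ℝ) ×ˢ Ioo (-Real.pi) Real.pi) :=
    measurableSet_Ioi.prod measurableSet_Ioo
  have h1 := integrableOn_polarCoord_symm hgi
  have h2 := integral_comp_polarCoord_symm g
  rw [polarCoord_target] at h1 h2
  refine ⟨h1.congr_fun heq hm, ?_⟩
  rw [← setIntegral_congr_fun hm heq, h2, ← hmp.integral_comp']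

/-- Signed radii cover the plane twice: the negative half is the positive half for `x ↦ G (-x)`. -/
theorem polar_signed {G : Plane → ℂ} (hG : Integrable G) :
    Integrable (fun p : ℝ × ℝ => (|p.1| : ℝ) • G (p.1 • direction p.2))
      (volume.prod (volume.restrict (Ioo (-Real.pi) Real.pi))) ∧
    ∫ p, (|p.1| : ℝ) • G (p.1 • direction p.2)
      ∂((volume : Measure ℝ).prod (volume.restrict (Ioo (-Real.pi) Real.pi))) = 2 * ∫ x, G x := by
  obtain ⟨a1, a2⟩ := polar_half hG
  obtain ⟨b1, b2⟩ := polar_half hG.comp_neg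
  set K : ℝ × ℝ → ℂ := fun p => (|p.1| : ℝ) • G (p.1 • direction p.2) with hK
  set I := Ioo (-Real.pi) Real.pi
  let e : ℝ × ℝ ≃ᵐ ℝ × ℝ := (MeasurableEquiv.neg ℝ).prodCongr (MeasurableEquiv.refl ℝ)
  have he : MeasurePreserving e volume volume :=
    (Measure.measurePreserving_neg (volume : Measure ℝ)).prod (MeasurePreserving.id volume)
  have hpre : e ⁻¹' (Iic 0 ×ˢ I) = Ici 0 ×ˢ I := by
    ext p; simp [e, MeasurableEquiv.prodCongr, MeasurableEquiv.neg]
  have hae : (Ioi (0 : ℝ) ×ˢ I : Set (ℝ × ℝ)) =ᵐ[volume] (Ici (0 : ℝ) ×ˢ I : Set (ℝ × ℝ)) :=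
    Measure.set_prod_ae_eq Ioi_ae_eq_Ici (ae_eq_refl _)
  have hKe : (fun p : ℝ × ℝ => (|p.1| : ℝ) • G (-(p.1 • direction p.2))) = K ∘ e := by
    funext p
    simp [hK, e, MeasurableEquiv.prodCongr, MeasurableEquiv.neg]
  have c1 : IntegrableOn K (Iic 0 ×ˢ I) := by
    rw [← he.integrableOn_comp_preimage e.measurableEmbedding, hpre, ← hKe]
    exact b1.congr_set_ae hae.symm
  have c2 : ∫ p in Iic (0 : ℝ) ×ˢ I, K p = ∫ x, G x := by
    rw [← he.setIntegral_preimage_emb e.measurableEmbedding, hpre, ← setIntegral_congr_set hae]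
    rw [← integral_neg_eq_self G, ← b2]
    exact congrArg (fun F : ℝ × ℝ → ℂ => ∫ p in Ioi (0 : ℝ) ×ˢ I, F p) hKe.symm
  have hun : (univ : Set ℝ) ×ˢ I = (Ioi 0 ×ˢ I) ∪ (Iic 0 ×ˢ I) := by
    rw [← union_prod, Ioi_union_Iic]
  have hdis : Disjoint (Ioi (0 : ℝ) ×ˢ I) (Iic 0 ×ˢ I) :=
    Disjoint.set_prod_left (by rw [disjoint_comm]; exact Iic_disjoint_Ioi le_rfl) _ _
  have hmeas : (volume : Measure ℝ).prod (volume.restrict I) =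
      volume.restrict ((Ioi 0 ×ˢ I) ∪ (Iic 0 ×ˢ I)) := by
    rw [← hun, Measure.volume_eq_prod, ← Measure.prod_restrict, Measure.restrict_univ]
  rw [hmeas]
  refine ⟨a1.union c1, ?_⟩
  rw [setIntegral_union hdis (measurableSet_Iic.prod measurableSet_Ioo) a1 c1, a2, c2, two_mul]

/-! ### Filtered back projection -/

theorem inner_direction (x : Plane) (ϑ : ℝ) :
    inner ℝ (direction ϑ) x = x 0 * Real.cos ϑ + x 1 * Real.sin ϑ := by
  rw [direction, PiLp.inner_apply, Fin.sum_univ_two]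
  simp

theorem zeroExt_ae_eq_radon {f : Plane → ℝ} {u : ℝ × ℝ → ℝ}
    (h0 : ∀ ϑ t : ℝ, 1 ≤ |t| → radon f (ϑ, t) = 0)
    (hu : u =ᵐ[volume.restrict Omega] radon f) :
    ∀ᵐ ϑ ∂(volume.restrict (Ioo (-Real.pi) Real.pi)),
      (fun t : ℝ => zeroExt u (ϑ, t)) =ᵐ[volume] fun t => (radon f (ϑ, t) : ℂ) := by
  rw [Omega, Measure.volume_eq_prod, ← Measure.prod_restrict] at hu
  filter_upwards [Measure.ae_ae_of_ae_prod hu, ae_restrict_mem measurableSet_Ioo] with ϑ h hϑ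
  filter_upwards [(ae_restrict_iff' measurableSet_Ioo).1 h] with t ht
  by_cases htm : t ∈ Ioo (-1 : ℝ) 1
  · have hm : (ϑ, t) ∈ Omega := ⟨hϑ, htm⟩
    rw [zeroExt, indicator_of_mem hm, ht htm]
  · have hm : (ϑ, t) ∉ Omega := fun h => htm h.2
    rw [zeroExt, indicator_of_notMem hm, h0 ϑ t]
    by_contra! h; exact htm (abs_lt.1 h)

theorem integrable_radon_line {f : Plane → ℝ} (hc : Continuous (radon f))
    (h0 : ∀ ϑ t : ℝ, 1 ≤ |t| → radon f (ϑ, t) = 0) (ϑ : ℝ) :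
    Integrable fun t : ℝ => (radon f (ϑ, t) : ℂ) := by
  refine Integrable.ofReal (Continuous.integrable_of_hasCompactSupport
    (hc.comp (Continuous.prodMk_right ϑ)) ?_)
  refine HasCompactSupport.of_support_subset_isCompact (isCompact_Icc (a := (-1 : ℝ)) (b := 1))
    fun t ht => ?_
  by_contra hn
  refine ht (h0 ϑ t ?_)
  by_contra! h
  exact hn ⟨(abs_lt.1 h).1.le, (abs_lt.1 h).2.le⟩

/-- The ramp `|S|` is the Jacobian of signed polar coordinates, so back projection becomes Fourier
inversion. Fubini's theorem in these coordinates also gives the absolute convergence, with `G`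
needed only for almost every angle. -/
theorem filtered_back_projection {f : Plane → ℝ} (hf : Continuous f)
    (hfi : Integrable fun x => (f x : ℂ)) (hF : Integrable (𝓕 fun x : Plane => (f x : ℂ)))
    {G : ℝ × ℝ → ℂ} (hG : ∀ᵐ ϑ ∂(volume.restrict (Ioo (-Real.pi) Real.pi)), ∀ S : ℝ,
      G (ϑ, S) = 𝓕 (fun x : Plane => (f x : ℂ)) ((S / (2 * Real.pi)) • direction ϑ)) :
    (∀ᵐ ϑ ∂(volume.restrict (Ioo (-Real.pi) Real.pi)), Integrable fun S : ℝ => ramp G (ϑ, S)) ∧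
    ∀ x : Plane, IntegrableOn (backProjectionIntegrand (invFourier1 (ramp G)) x)
        (Ioo (-Real.pi) Real.pi) ∧
      (f x : ℂ) = 1 / (4 * (Real.pi : ℂ)) * backProjection (invFourier1 (ramp G)) x := by
  have hpi := Real.pi_pos
  have hpi0 : (Real.pi : ℂ) ≠ 0 := by exact_mod_cast Real.pi_ne_zero
  have hscale : (2 * Real.pi) ≠ 0 := by positivity
  set F := 𝓕 fun x : Plane => (f x : ℂ) with hFdef
  refine ⟨?_, fun x => ?_⟩
  · filter_upwards [(polar_signed hF).1.prod_left_ae, hG] with ϑ h1 h2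
    have h3 := (h1.comp_mul_right' (inv_ne_zero hscale)).const_mul ((2 * Real.pi : ℝ) : ℂ)
    refine h3.congr (Eventually.of_forall fun S => ?_)
    simp only [ramp, h2, ← div_eq_mul_inv, abs_div, abs_of_pos (by positivity : 0 < 2 * Real.pi),
      Complex.real_smul]
    push_cast
    field_simp
  · set g : Plane → ℂ := fun ξ => Real.fourierChar (inner ℝ ξ x) • F ξ with hg
    have hgi : Integrable g := by
      have := (Real.fourierIntegral_convergent_iff (-x)).2 hF
      simpa [hg] using this
    have hinv : ∫ ξ, g ξ = f x := by
      have := congrFun ((Complex.continuous_ofReal.comp hf).fourierInv_fourier_eq hfi hF) x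
      rw [Real.fourierInv_eq] at this
      exact this
    obtain ⟨p1, p2⟩ := polar_signed hgi
    -- Substituting `S = 2πσ` gives one factor `2π` from `dS` and one from `|S|`, and `invFourier1`
    -- removes one. The double covering supplies the remaining 2 of `4π`.
    have hB : (fun ϑ => 2 * (Real.pi : ℂ) * ∫ σ : ℝ, (|σ| : ℝ) • g (σ • direction ϑ)) =ᵐ[
        volume.restrict (Ioo (-Real.pi) Real.pi)]
        backProjectionIntegrand (invFourier1 (ramp G)) x := by
      filter_upwards [hG] with ϑ h
      rw [backProjectionIntegrand, invFourier1]
      have hsub := Measure.integral_comp_mul_left (fun S : ℝ => ramp G (ϑ, S) * Complex.exp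
        (Complex.I * (S : ℂ) * ((x 0 * Real.cos ϑ + x 1 * Real.sin ϑ : ℝ) : ℂ))) (2 * Real.pi)
      rw [abs_of_pos (by positivity), eq_inv_smul_iff₀ hscale] at hsub
      simp only
      rw [← hsub, Complex.real_smul, ← mul_assoc, Complex.ofReal_mul, Complex.ofReal_ofNat,
        one_div_mul_cancel (by simp), one_mul, ← integral_const_mul]
      congr 1; funext σ
      simp only [ramp, h, hg, Circle.smul_def, Real.fourierChar_apply, inner_smul_left,
        inner_direction, mul_div_cancel_left₀ σ hscale, abs_mul,
        abs_of_pos (by positivity : 0 < 2 * Real.pi), Complex.real_smul, smul_eq_mul]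
      have e : ((2 * Real.pi * ((starRingEnd ℝ) σ * (x 0 * Real.cos ϑ + x 1 * Real.sin ϑ)) : ℝ) : ℂ) *
          Complex.I = Complex.I * ((2 * Real.pi * σ : ℝ) : ℂ) *
            ((x 0 * Real.cos ϑ + x 1 * Real.sin ϑ : ℝ) : ℂ) := by
        simp only [conj_trivial]; push_cast; ring
      rw [e]; push_cast; ring
    refine ⟨(p1.integral_prod_right.const_mul _).congr hB, ?_⟩
    rw [backProjection, ← integral_congr_ae hB, integral_const_mul,
      ← integral_prod_symm _ p1, p2, hinv]
    field_simp
    ring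

theorem exists_radius {f : Plane → ℝ} (hf : tsupport f ⊆ Metric.ball 0 1) :
    ∃ r, 0 < r ∧ r < 1 ∧ ∀ x, r ≤ ‖x‖ → f x = 0 := by
  obtain ⟨r, hr, h⟩ := exists_pos_lt_subset_ball one_pos (isClosed_tsupport f) hf
  refine ⟨r, hr.1, hr.2, fun x hx => image_eq_zero_of_notMem_tsupport fun hxs => ?_⟩
  have := mem_ball_zero_iff.1 (h hxs)
  linarith

theorem continuous_of_continuousOn_closedBall {f : Plane → ℝ}
    (hc : ContinuousOn f (Metric.closedBall 0 1)) (hs : tsupport f ⊆ Metric.ball 0 1) :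
    Continuous f :=
  continuous_of_tsupport fun _ hx => hc.continuousAt
    (mem_of_superset (Metric.isOpen_ball.mem_nhds (hs hx)) Metric.ball_subset_closedBall)

end ModuloRadon

theorem theorem1 (lam : ℝ) (hlam : 0 < lam) (f : Plane → ℝ)
    (hf_cont : ContinuousOn f (Metric.closedBall 0 1))
    (hf_compact : HasCompactSupport f)
    (hf_supp : tsupport f ⊆ Metric.ball 0 1)
    (hf_fourier : Integrable (𝓕 (fun x : Plane => (f x : ℂ))))
    (hR : ContDiffOn ℝ 2 (radon f) (closure Omega)) :
    -- the right-hand side is classically defined and square-integrable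
    ContDiffOn ℝ 2 (sinPhase lam (moduloRadon lam f)) (closure Omega) ∧
    ContDiffOn ℝ 2 (cosPhase lam (moduloRadon lam f)) (closure Omega) ∧
    MemL2per (poissonRhs lam (moduloRadon lam f)) ∧
    -- the Poisson problem has a weak solution, unique almost everywhere
    (∃ u, IsWeakSolution (poissonRhs lam (moduloRadon lam f)) u) ∧
    (∀ u₁ u₂, IsWeakSolution (poissonRhs lam (moduloRadon lam f)) u₁ →
      IsWeakSolution (poissonRhs lam (moduloRadon lam f)) u₂ →
      u₁ =ᵐ[volume.restrict Omega] u₂) ∧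
    -- filtered back projection of the weak solution is well defined and returns `f`
    (∀ u, IsWeakSolution (poissonRhs lam (moduloRadon lam f)) u →
      (∀ᵐ ϑ ∂(volume.restrict (Ioo (-Real.pi) Real.pi)),
        Integrable (fun t : ℝ => zeroExt u (ϑ, t)) ∧
        Integrable (fun S : ℝ => ramp (fourier1 (zeroExt u)) (ϑ, S))) ∧
      ∀ x : Plane,
        IntegrableOn (backProjectionIntegrand (invFourier1 (ramp (fourier1 (zeroExt u)))) x)
          (Ioo (-Real.pi) Real.pi) ∧
        (f x : ℂ) = 1 / (4 * (Real.pi : ℂ)) *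
          backProjection (invFourier1 (ramp (fourier1 (zeroExt u)))) x) := by
  have hf := continuous_of_continuousOn_closedBall hf_cont hf_supp
  have hfi : Integrable fun x => (f x : ℂ) :=
    (hf.integrable_of_hasCompactSupport hf_compact).ofReal
  obtain ⟨r, hr0, hr1, hfr⟩ := exists_radius hf_supp
  have hRr := radon_eq_zero hfr
  have hR2 : ContDiff ℝ 2 (radon f) := contDiff_radon hr1 hfr hR
  have hsol := isWeakSolution_laplace hR2 (radon_add_two_pi f) hr0 hr1 hRr
  have h1 : ∀ ϑ t : ℝ, 1 ≤ |t| → radon f (ϑ, t) = 0 := fun ϑ t ht => hRr ϑ t (hr1.le.trans ht)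
  rw [sinPhase_moduloRadon hlam, cosPhase_moduloRadon hlam, poissonRhs_moduloRadon hlam,
    poissonRhs_eq_laplace hlam hR2]
  refine ⟨(contDiff_const.mul hR2).sin.contDiffOn, (contDiff_const.mul hR2).cos.contDiffOn,
    memL2per_of_continuous (continuous_laplace hR2), ⟨_, hsol⟩, fun _ _ h h' => h.ae_eq h',
    fun u hu => ?_⟩
  -- By uniqueness the arbitrary solution `u` may be replaced by `radon f` on almost every vertical
  -- slice, which is all the Fourier integrals see.
  have hext := zeroExt_ae_eq_radon h1 (hu.ae_eq hsol)
  have hG : ∀ᵐ ϑ ∂(volume.restrict (Ioo (-Real.pi) Real.pi)), ∀ S : ℝ,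
      fourier1 (zeroExt u) (ϑ, S) =
        𝓕 (fun x : Plane => (f x : ℂ)) ((S / (2 * Real.pi)) • direction ϑ) := by
    filter_upwards [hext] with ϑ h S
    rw [← integral_radon_mul_exp hfi, fourier1]
    refine integral_congr_ae ?_
    filter_upwards [h] with t ht
    rw [ht]
  obtain ⟨hramp, hx⟩ := filtered_back_projection hf hfi hf_fourier hG
  refine ⟨?_, hx⟩
  filter_upwards [hext, hramp] with ϑ h h'
  exact ⟨(integrable_radon_line hR2.continuous h1 ϑ).congr h.symm, h'⟩
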